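/- **Setting.** Spinors have components $v^\alpha$, $\alpha=0,1$, with $v_\alpha=v^\beta\epsilon_{\beta\alpha}$, $v^\alpha=v_\beta\epsilon^{\alpha\beta}$, $\epsilon^{01}=\epsilon_{01}=1$, and $\langle a\,b\rangle=a^\alpha b_\alpha$; the same conventions hold for dotted spinors, with $[a\,b]=a^{\dot\alpha}b_{\dot\alpha}$. Generating functions are formal power series in $y^\alpha,\tilde y^{\dot\alpha}$, and $[y\,a]:=\tilde y^{\dot\alpha}a_{\dot\alpha}$. A poly-differential operator $F$ acts by $F(\Phi_1,\dots,\Phi_n)=F(y,\tilde y,\partial_i,\tilde\partial_i)\,\Phi_1(y_1,\tilde y_1)\cdots\Phi_n(y_n,\tilde y_n)\big|_{y_i=\tilde y_i=0}$; its value is organised as a sum over the total number $d$ of derivatives, each coefficient of each term being a finite sum. **Vertices (vanishing cosmological constant).** Let $n\ge2$ and $1\le i<j\le n$. Put $\partial_0:=-y$ and place $0,1,\dots,n$ on a circle in cyclic order. A graph $G\in\mathcal G_{ij}$ is an ordering $\tau_1,\dots,\tau_{n-1}$ of $\{0,\dots,n\}\setminus\{i,j\}$ that is a shuffle of the two arcs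 $(j+1,\dots,n,0,1,\dots,i-1)$ and $(j-1,j-2,\dots,i+1)$. Let $\Delta_{n-2}$ be the set of $(u_1,\dots,u_{n-2},v_1,\dots,v_{n-2})$ such that, with $u_{n-1}=1-\sum_{k\le n-2} u_k$ and $v_{n-1}=1-\sum_{k\le n-2} v_k$, all $u_r,v_r\ge0$ and $\frac{u_1}{v_1}\le\dots\le\frac{u_{n-1}}{v_{n-1}}$ (that is, $u_rv_{r'}\le u_{r'}v_r$ for $r<r'$). The $y$-sector of the sub-vertex with the two 1-forms in positions $i<j$ is $$V_{ij}(y;\partial_1,\dots,\partial_n)=(-1)^{i+j-1}\langle\partial_i\,\partial_j\rangle^{n-2}\sum_{G\in\mathcal G_{ij}}\int_{\Delta_{n-2}}\exp\Big(\sum_{r=1}^{n-1}u_r\langle\partial_i\,\partial_{\tau_r}\rangle+v_r\langle\partial_j\,\partial_{\tau_r}\rangle\Big).$$ The natural pairing gives the sub-vertices $U_p$ with one 1-form, in position $p$, and $n-1$ zero-forms: $$U_p(y;\partial_1,\dots,\partial_n)=V_{1,p+1}(-\partial_n;y,\partial_1,\dots,\partial_{n-1})\quad(p<n),\qquad U_n(y;\partial_1,\dots,\partial_n)=-V_{n-1,n}(-\partial_1;\partial_2,\dots,\partial_n,y).$$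 Put $\mho_n=\exp\big(\sum_i[y\,\partial_i]+\sum_{i<j}[\partial_i\,\partial_j]\big)$. The vertex is $$\mathcal U_n(\omega,\mathsf C,\dots,\mathsf C)=c_n\sum_{p=1}^n\mho_n\,U_p(\mathsf C,\dots,\mathsf C,\underset{p}{\omega},\mathsf C,\dots,\mathsf C),\qquad c_2=\tfrac12,\quad c_n=1\ (n\ge3).$$ **Fields.** Let $M$ be an open subset of complexified flat space $\mathbb C^4$ with coordinates $x^{\alpha\dot\alpha}$, $h^{\alpha\dot\alpha}=dx^{\alpha\dot\alpha}$, $\nabla=d$. Let $\lambda,\mu,\tilde\lambda,\tilde\mu$ be constant spinors with $\langle\mu\,\lambda\rangle=1=[\tilde\mu\,\tilde\lambda]$, and put $\ell=\lambda\tilde\lambda$, $p=\lambda\tilde\mu$, $\tilde p=\mu\tilde\lambda$ and $[y\,\lambda]:=[y\,\tilde\lambda]$. Let $\mathtt H_s$ ($s\ge1$) and $\psi_s$ ($s\ge0$) be holomorphic functions on $M$ with $\ell^a\nabla_af=0$ and $p^a\tilde p^b\nabla_a\nabla_bf=0$, and let moreover $\tilde p^a\nabla_a\mathtt H_s=0$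 (so $\mathtt H_s$ has no derivatives in the $\tilde y$-sector). Let $\mathtt H_s(y)$ be the solution of $\nabla\mathtt H_s(y)=\tilde\lambda_{\dot\beta}h^{\alpha\dot\beta}\partial_\alpha\mathtt H_s(y)$ with $\mathtt H_s(0)=\mathtt H_s$. Define, with $N_y=y^\alpha\partial_\alpha$, $$\omega=\sum_{s\ge1}\frac{\langle\lambda|h|\lambda]}{(2s-2)!}\big(\langle y\,\lambda\rangle+[y\,\lambda]\langle\lambda\,\partial'\rangle\big)^{2s-2}\mathtt H_s(y')\Big|_{y'=0},\qquad C=\sum_{s\ge1}\frac{1}{(2s+N_y)!}[y\,\lambda]^{2s+N_y}\langle\lambda\,\partial'\rangle^{2s-1}\mathtt H_s(y')\Big|_{y'=y},$$ where $\langle\lambda|h|\lambda]=\lambda^\gamma h_{\gamma\dot\gamma}\tilde\lambda^{\dot\gamma}$. Let $B=\sum_{s\ge0}B_s$, where $B_s$ is any formal power series in $\langle y\,\lambda\rangle,\langle y\,\mu\rangle,[y\,\lambda]$, with coefficients that are functions on $M$, all of whose terms have degree $2s+m$ in $y$ and $m$ in $\tilde y$ for some $m\ge0$, and whose part with $m=0$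 is $\psi_s\langle y\,\mu\rangle^{2s}/(2s)!$ (that is, $B^{\alpha(2s)}=\psi_s\mu^{\alpha(2s)}$). **Theorem.** For these $\omega$ and $\mathsf C=C+B$, every vertex $\mathcal U_n(\omega,\mathsf C,\dots,\mathsf C)$ with $n\ge2$ vanishes on $M$. More precisely, for each $d$ the part of $\mathcal U_n(\omega,\mathsf C,\dots,\mathsf C)$ with $d$ derivatives vanishes, so the sum over $d$ converges coefficientwise to $0$. -/

import Mathlib

open scoped Nat

noncomputable section

namespace ChiralHS

/-! ### Spinors, generating functions and symbols

Spinor conventions: `v_α = v^β ε_{βα}`, `v^α = v_β ε^{αβ}`, `ε^{01} = ε_{01} = 1`, and the same for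
dotted indices.  A spinor is stored through its upper components. -/

/-- The contraction `a^α b_α = a^1 b^0 - a^0 b^1` of two spinors with components in `R`.
It is used both for `⟨a b⟩` (undotted) and for `[a b]` (dotted). -/
def ang {R : Type*} [CommRing R] (a b : Fin 2 → R) : R := a 1 * b 0 - a 0 * b 1

/-- The index set of the variables `Y = (y^α, ỹ^α̇)`: `inl α` is `y^α`, `inr α̇` is `ỹ^α̇`. -/
abbrev SpVar : Type := Fin 2 ⊕ Fin 2

/-- Generating functions: formal power series in `y^0, y^1, ỹ^0, ỹ^1`. -/
abbrev GF : Type := MvPowerSeries SpVar ℂ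

/-- Symbols of poly-differential operators with `n` arguments.  Slot `0` carries the output
variables `y^α, ỹ^α̇`; slot `i ≥ 1` carries the derivatives `∂_{iα} = ∂/∂y_i^α`,
`∂̃_{iα̇} = ∂/∂ỹ_i^α̇` acting on the `i`-th argument. -/
abbrev Symb (n : ℕ) : Type := MvPowerSeries (Fin (n + 1) × SpVar) ℂ

/-- The undotted spinors of the slots (upper components): `y^α` in slot `0`, and
`∂_i^α = ∂_{iβ} ε^{αβ}` in slot `i`. -/
def slotY (n : ℕ) (k : Fin (n + 1)) : Fin 2 → Symb n :=
  if k = 0 then ![MvPowerSeries.X (0, Sum.inl 0), MvPowerSeries.X (0, Sum.inl 1)]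
  else ![MvPowerSeries.X (k, Sum.inl 1), -MvPowerSeries.X (k, Sum.inl 0)]

/-- The dotted spinors of the slots (upper components). -/
def slotYt (n : ℕ) (k : Fin (n + 1)) : Fin 2 → Symb n :=
  if k = 0 then ![MvPowerSeries.X (0, Sum.inr 0), MvPowerSeries.X (0, Sum.inr 1)]
  else ![MvPowerSeries.X (k, Sum.inr 1), -MvPowerSeries.X (k, Sum.inr 0)]

/-- The exponential `exp E` of a formal power series without constant term. -/
def fexp {σ : Type*} (E : MvPowerSeries σ ℂ) : MvPowerSeries σ ℂ :=
  (PowerSeries.exp ℂ).subst E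

/-! ### Action of a poly-differential operator

`F(Φ_1, …, Φ_n) = F(y, ỹ, ∂_i, ∂̃_i) Φ_1(y_1, ỹ_1) ⋯ Φ_n(y_n, ỹ_n)` at `y_i = ỹ_i = 0`.
A monomial of `F` that contains `d` derivatives and produces an output monomial of degree `e` comes
from `(d - e) / 2` contractions between arguments, so for each output coefficient the terms are
organised by the number of contractions, i.e. by the total number `d` of derivatives; each of these
terms is a finite sum. -/

/-- The multi-index over all slots which is `e` in slot `0` and `K (i, ·)` in the slot of the
`i`-th argument. -/
def joinIdx {n : ℕ} (e : SpVar →₀ ℕ) (K : (Fin n × SpVar) →₀ ℕ) :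
    (Fin (n + 1) × SpVar) →₀ ℕ :=
  Finsupp.equivFunOnFinite.symm fun q =>
    Fin.cases (motive := fun _ => ℕ) (e q.2) (fun i => K (i, q.2)) q.1

/-- The part of `F(Φ_1, …, Φ_n)` that contains exactly `d` derivatives; note that
`∂^K Φ |_0 = K! · coeff_K Φ`. -/
def polyDiffPart {n : ℕ} (F : Symb n) (Φ : Fin n → GF) (d : ℕ) : GF := fun e =>
  ∑ K ∈ Finset.finsuppAntidiag (Finset.univ : Finset (Fin n × SpVar)) d,
    MvPowerSeries.coeff (joinIdx e K) F * (∏ q, ((K q)! : ℂ)) *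
      ∏ i, MvPowerSeries.coeff
        (Finsupp.equivFunOnFinite.symm fun s : SpVar => K (i, s)) (Φ i)

/-! ### Vertices of chiral higher-spin gravity with vanishing cosmological constant

A vertex with `n = N + 2` arguments has `N` integration variables `u_1, …, u_N` and `N`
integration variables `v_1, …, v_N`. -/

/-- `(u_1, …, u_N, 1 - ∑ u_i)`. -/
def extend {N : ℕ} (u : Fin N → ℝ) : Fin (N + 1) → ℝ := Fin.snoc u (1 - ∑ k, u k)

/-- The integration domain: `u_1/v_1 ≤ u_2/v_2 ≤ … ≤ u_N/v_N ≤ (1 - ∑ u_i)/(1 - ∑ v_i)`, where all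
numerators and denominators are non-negative.  The inequalities between slopes are
cross-multiplied. -/
def domainΔ (N : ℕ) : Set ((Fin N → ℝ) × (Fin N → ℝ)) :=
  {w | (∀ r, 0 ≤ extend w.1 r) ∧ (∀ r, 0 ≤ extend w.2 r) ∧
    ∀ r r', r < r' → extend w.1 r * extend w.2 r' ≤ extend w.1 r' * extend w.2 r}

/-- The graphs `G_{ij}` contributing to the sub-vertex of `V` whose 1-forms are in slots `i < j`.
The output (slot `0`) and the arguments (slots `1, …, N + 2`) are placed on a circle in cyclic
order.  The slots `i` and `j` are the ends of a line that divides the remaining slots into two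
arcs: `j+1, …, N+2, 0, 1, …, i-1` and `j-1, j-2, …, i+1`, both read from `j` to `i`.  A graph
attaches all these slots to the line so that the order on each arc is kept: `τ r` is the slot
attached at the `r`-th place, and `τ` is a shuffle of the two arcs.  Differences of slots are
cyclic distances. -/
def IsGraph {N : ℕ} (i j : Fin (N + 3)) (τ : Fin (N + 1) → Fin (N + 3)) : Prop :=
  Function.Injective τ ∧ (∀ r, τ r ≠ i ∧ τ r ≠ j) ∧
    ∀ r r', r < r' →
      ((i < τ r ∧ τ r < j) → (i < τ r' ∧ τ r' < j) → j - τ r < j - τ r') ∧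
      (¬ (i < τ r ∧ τ r < j) → ¬ (i < τ r' ∧ τ r' < j) → τ r - j < τ r' - j)

open scoped Classical in
/-- The finite set of the graphs `G_{ij}`. -/
def graphs {N : ℕ} (i j : Fin (N + 3)) : Finset (Fin (N + 1) → Fin (N + 3)) :=
  Finset.univ.filter (IsGraph i j)

/-- The spinor attached to the line by a slot: `∂_k` for an argument, `-y` for the output (so that
`⟨∂_i (-y)⟩ = ⟨y ∂_i⟩`). -/
def leaf {R : Type*} [CommRing R] {N : ℕ} (a : Fin (N + 3) → Fin 2 → R) (k : Fin (N + 3)) :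
    Fin 2 → R :=
  if k = 0 then -a 0 else a k

/-- The exponent `tr (P_G Qᵀ)` at the integration point `w = (u, v)`: the sum over the places `r`
of the line of `u_r ⟨∂_i leaf_{τ r}⟩ + v_r ⟨∂_j leaf_{τ r}⟩`. -/
def exponent {σ : Type*} {N : ℕ} (a : Fin (N + 3) → Fin 2 → MvPowerSeries σ ℂ)
    (i j : Fin (N + 3)) (τ : Fin (N + 1) → Fin (N + 3)) (w : (Fin N → ℝ) × (Fin N → ℝ)) :
    MvPowerSeries σ ℂ :=
  ∑ r, (((extend w.1 r : ℝ) : ℂ) • ang (a i) (leaf a (τ r)) +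
    ((extend w.2 r : ℝ) : ℂ) • ang (a j) (leaf a (τ r)))

/-- The `y`-sector of the sub-vertex `V_{C,…,ω_i,…,ω_j,…,C}` with `N + 2` arguments, as a function
of the spinors `a 0 = y` and `a k = ∂_k`:
`(-1)^{i+j-1} ⟨∂_i ∂_j⟩^N ∑_G ∫_Δ exp tr (P_G Qᵀ)`, integrated coefficientwise. -/
def VSub {σ : Type*} {N : ℕ} (i j : Fin (N + 3)) (a : Fin (N + 3) → Fin 2 → MvPowerSeries σ ℂ) :
    MvPowerSeries σ ℂ :=
  ((-1 : ℂ) ^ (i.val + j.val + 1)) • (ang (a i) (a j) ^ N *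
    ∑ τ ∈ graphs i j, (show MvPowerSeries σ ℂ from fun m =>
      ∫ w in domainΔ N, MvPowerSeries.coeff m (fexp (exponent a i j τ w))))

/-- The `y`-sector of the sub-vertex `U_{C,…,ω,…,C}` with `N + 2` arguments and the 1-form in
position `p + 1` (so `p = 0` is the first position), obtained from the sub-vertices `V` through the
natural pairing:
* if the last argument is a 0-form, `⟨V(ω,…,ω,…,C) | C⟩ = ⟨ω | U(…,ω,…,C)⟩`, i.e.
  `U(y; ∂_1, …, ∂_n) = V(-∂_n; y, ∂_1, …, ∂_{n-1})`;
* if the 1-form is the last argument, `⟨C | V(C,…,ω,ω)⟩ = -⟨U(C,C,…,ω) | ω⟩`, i.e.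
  `U(y; ∂_1, …, ∂_n) = -V(-∂_1; ∂_2, …, ∂_n, y)`.
The spinor of the output slot comes first; slots are counted cyclically. -/
def USub {σ : Type*} {N : ℕ} (p : Fin (N + 2)) (a : Fin (N + 3) → Fin 2 → MvPowerSeries σ ℂ) :
    MvPowerSeries σ ℂ :=
  if p ≠ Fin.last (N + 1) then
    VSub 1 (p.succ + 1) (fun k => if k = 0 then -a (k - 1) else a (k - 1))
  else
    -VSub (Fin.last (N + 2) - 1) (Fin.last (N + 2))
      (fun k => if k = 0 then -a (k + 1) else a (k + 1))

/-- The operator `exp (∑_i [y ∂_i] + ∑_{i<j} [∂_i ∂_j])` acting in the `ỹ`-sector. -/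
def mho (n : ℕ) : Symb n :=
  fexp (∑ i : Fin n, ang (slotYt n 0) (slotYt n i.succ) +
    ∑ i : Fin n, ∑ j : Fin n,
      if i < j then ang (slotYt n i.succ) (slotYt n j.succ) else 0)

/-- The full symbol of the sub-vertex `U_{C,…,ω,…,C}` with `N + 2` arguments; the quadratic
vertex carries the overall normalisation `1/2`. -/
def USymb (N : ℕ) (p : Fin (N + 2)) : Symb (N + 2) :=
  (if N = 0 then (1 / 2 : ℂ) else 1) • (mho (N + 2) * USub p (slotY (N + 2)))

/-- The part with `d` derivatives of the vertex
`𝒰_n(ω, C, …, C) = U_{ω,C,…,C} + U_{C,ω,C,…,C} + … + U_{C,…,C,ω}`, `n = N + 2`. -/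
def UVertexPart (N : ℕ) (ω C : GF) (d : ℕ) : GF :=
  ∑ p : Fin (N + 2), polyDiffPart (USymb N p) (fun k => if k = p then ω else C) d

/-- `𝒰_n(ω, C, …, C) = Ψ` with `n = N + 2`: for every monomial in `(y, ỹ)`, the sum over the number
of derivatives converges to the coefficient of `Ψ`. -/
def UVertexEq (N : ℕ) (ω C Ψ : GF) : Prop :=
  ∀ e, HasSum (fun d => MvPowerSeries.coeff e (UVertexPart N ω C d)) (MvPowerSeries.coeff e Ψ)

/-! ### Spacetime and profile functions -/

/-- Complexified flat spacetime with coordinates `x^{αα̇}`; the vierbein is `h^{αα̇} = dx^{αα̇}` and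
`∇ = d`. Tangent vectors are elements of the same space. -/
abbrev Spacetime : Type := Fin 2 → Fin 2 → ℂ

/-- The vector `a^α b^α̇`. -/
def outer (a b : Fin 2 → ℂ) : Spacetime := fun α α' => a α * b α'

/-- The directional derivative `v^a ∇_a f`. -/
def dirD (v : Spacetime) (f : Spacetime → ℂ) : Spacetime → ℂ := fun x => fderiv ℂ f x v

/-- `f` is a holomorphic function on `M` with `ℓ^a ∇_a f = 0` and `p^a p̃^b ∇_a ∇_b f = 0`, where
`ℓ = λ λ̃`, `p = λ μ̃`, `p̃ = μ λ̃`. -/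
def IsHarmonicProfile (M : Set Spacetime) (lam lamd mu mud : Fin 2 → ℂ) (f : Spacetime → ℂ) :
    Prop :=
  DifferentiableOn ℂ f M ∧ ∀ x ∈ M, dirD (outer lam lamd) f x = 0 ∧
    dirD (outer lam mud) (dirD (outer mu lamd) f) x = 0

/-- The generating function `H(x; y)` of the undotted derivatives of a profile `H`: the solution of
`∇ H(y) = λ̃_β̇ h^{αβ̇} ∂_α H(y)`, `H(x; 0) = H(x)`.  As `[μ̃ λ̃] = 1`, contracting with
`μ̃^β̇` gives `∂_α H(y) = μ̃^β̇ ∇_{αβ̇} H(y)`, whence its Taylor coefficients. -/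
def profileGF (mud : Fin 2 → ℂ) (H : Spacetime → ℂ) (x : Spacetime) :
    MvPowerSeries (Fin 2) ℂ := fun m =>
  (((m 0)! : ℂ) * ((m 1)! : ℂ))⁻¹ *
    ((dirD (outer (Pi.single 0 1) mud))^[m 0] ((dirD (outer (Pi.single 1 1) mud))^[m 1] H)) x

/-- `⟨λ ∂'⟩ = λ^α ∂/∂y'^α`. -/
def lamD (lam : Fin 2 → ℂ) (f : MvPowerSeries (Fin 2) ℂ) : MvPowerSeries (Fin 2) ℂ :=
  ∑ α, lam α • MvPowerSeries.pderiv ℂ α f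

/-! ### Kerr–Schild-type fields -/

/-- The sum `∑_k f k` of formal power series such that `f k` contains only monomials of degree at
least `k`. -/
def formalSum {σ : Type*} (f : ℕ → MvPowerSeries σ ℂ) : MvPowerSeries σ ℂ := fun m =>
  ∑ k ∈ Finset.range (m.degree + 1), MvPowerSeries.coeff m (f k)

/-- `⟨y a⟩ = y^α a_α`. -/
def brY (a : Fin 2 → ℂ) : GF :=
  ang ![MvPowerSeries.X (Sum.inl 0), MvPowerSeries.X (Sum.inl 1)] (fun α => MvPowerSeries.C (a α))

/-- `[y a] = ỹ^α̇ a_α̇`. -/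
def brYt (a : Fin 2 → ℂ) : GF :=
  ang ![MvPowerSeries.X (Sum.inr 0), MvPowerSeries.X (Sum.inr 1)] (fun α => MvPowerSeries.C (a α))

/-- The spin-`s` 1-form without its factor `⟨λ|h|λ]` (for `s ≥ 1`):
`1/(2s-2)! (⟨y λ⟩ + [y λ] ⟨λ ∂'⟩)^{2s-2} H_s(y') |_{y'=0}`, where `h = H_s(x; ·)`. -/
def omegaSpin (lam lamd : Fin 2 → ℂ) (h : MvPowerSeries (Fin 2) ℂ) (s : ℕ) : GF :=
  ((2 * s - 2)! : ℂ)⁻¹ • ∑ k ∈ Finset.range (2 * s - 2 + 1),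
    (((2 * s - 2).choose k : ℂ) * MvPowerSeries.constantCoeff ((lamD lam)^[k] h)) •
      (brY lam ^ (2 * s - 2 - k) * brYt lamd ^ k)

/-- The homogeneous part of degree `k` of a formal power series in `y`, as an element of `GF`. -/
def homPart (f : MvPowerSeries (Fin 2) ℂ) (k : ℕ) : GF :=
  ∑ m ∈ Finset.finsuppAntidiag (Finset.univ : Finset (Fin 2)) k,
    MvPowerSeries.coeff m f •
      (MvPowerSeries.X (Sum.inl 0) ^ m 0 * MvPowerSeries.X (Sum.inl 1) ^ m 1 : GF)

/-- The spin-`s` positive-helicity 0-form (for `s ≥ 1`):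
`1/(2s+N_y)! [y λ]^{2s+N_y} ⟨λ ∂'⟩^{2s-1} H_s(y') |_{y'=y}`, where `N_y = y^α ∂_α` is the degree in
`y` and `h = H_s(x; ·)`. -/
def CSpin (lam lamd : Fin 2 → ℂ) (h : MvPowerSeries (Fin 2) ℂ) (s : ℕ) : GF :=
  formalSum fun k => ((2 * s + k)! : ℂ)⁻¹ •
    (brYt lamd ^ (2 * s + k) * homPart ((lamD lam)^[2 * s - 1] h) k)

/-- `B` is (the value at a point of) a spin-`s` negative-helicity 0-form: a function of
`⟨y λ⟩, ⟨y μ⟩, [y λ]` whose components have `2s + m` undotted and `m` dotted indices, `m ≥ 0`,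
and whose component without dotted indices is `B^{α(2s)} = ψ_s μ^{α(2s)}`, that is
`ψ_s ⟨y μ⟩^{2s} / (2s)!` in `B`.  The case `s = 0` is the scalar. -/
def IsBSpin (lam lamd mu : Fin 2 → ℂ) (ψ : ℂ) (s : ℕ) (B : GF) : Prop :=
  ∃ β : ℕ → ℕ → ℂ, (∀ a, β 0 a = if a = 0 then ψ / ((2 * s)! : ℂ) else 0) ∧
    B = formalSum fun m => ∑ ab ∈ Finset.HasAntidiagonal.antidiagonal (2 * s + m),
      β m ab.1 • (brY lam ^ ab.1 * brY mu ^ ab.2 * brYt lamd ^ m)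

/-- The value `⟨λ|h|λ](ξ) = λ^γ h_{γγ̇}(ξ) λ̃^γ̇ = λ_γ λ̃_γ̇ ξ^{γγ̇}` on the tangent vector `ξ`;
the lower components are `λ_0 = -λ^1`, `λ_1 = λ^0`. -/
def lamHlam (lam lamd : Fin 2 → ℂ) (ξ : Spacetime) : ℂ :=
  ∑ γ, ∑ γ', (![-lam 1, lam 0] γ) * (![-lamd 1, lamd 0] γ') * ξ γ γ'

/-- The full 1-form `ω = ∑_{s ≥ 1} ω_s` at the point `x`, evaluated on the tangent vector `ξ`. -/
def omegaField (lam lamd mud : Fin 2 → ℂ) (H : ℕ → Spacetime → ℂ) (x ξ : Spacetime) : GF :=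
  lamHlam lam lamd ξ •
    formalSum fun t => omegaSpin lam lamd (profileGF mud (H (t + 1)) x) (t + 1)

/-- The full 0-form `∑_{s ≥ 1} C_s + ∑_{s ≥ 0} B_s` at the point `x`. -/
def zeroFormField (lam lamd mud : Fin 2 → ℂ) (H : ℕ → Spacetime → ℂ)
    (B : ℕ → Spacetime → GF) (x : Spacetime) : GF :=
  formalSum (fun t => CSpin lam lamd (profileGF mud (H (t + 1)) x) (t + 1)) +
    formalSum fun s => B s x

end ChiralHS

end

open scoped Nat

noncomputable section

namespace ChiralHS

open MvPowerSeries MeasureTheory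

/-! ### The exponential of a formal power series -/

/-! Both `ω` and the zero-form `c` depend on the dotted variables only through `[y λ]`, so `λ̃^α̇
∂̃_α̇` annihilates them (`dotD_omegaField`, `dotD_zeroFormField`). The dotted derivatives of any two
arguments are then parallel, every contraction `[∂_i ∂_j]` acts by zero, and `mho` may be replaced
by `mhoOutput`, which is symmetric in the arguments (`polyDiffPart_mho_mul`).

In the undotted sector, each graph of a sub-vertex is a line with ends `y` and the derivative on
`ω`, whose leaves are the derivatives on the zero-forms in some order. All zero-forms equal `c`, so
relabelling the arguments identifies the contributions of all graphs with one `basicValue`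
(`polyDiffPart_lineTerm`). When `ω` is last, the ends come in the opposite order, and a reflection
of the integration domain restores it at the price of a sign (`lineTerm_reflect`).

What remains is a signed count of graphs. A graph is a shuffle, determined by the places of one arc,
so binomial coefficients appear (`card_graphs`). With `p` counted from zero, position `p ≤ N`
contributes `(-1)^p (N+1 choose p)` and the last position contributes `(-1)^(N+1)`: together, the
alternating sum of a row of Pascal's triangle, which is zero. -/

theorem coeff_pow_eq_zero_of_degree_lt {σ : Type*} {E : MvPowerSeries σ ℂ}
    (hE : constantCoeff E = 0) {m : σ →₀ ℕ} {k : ℕ} (h : m.degree < k) : coeff m (E ^ k) = 0 := by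
  apply coeff_of_lt_order
  refine lt_of_lt_of_le ?_ (le_order_pow_of_constantCoeff_eq_zero k hE)
  exact_mod_cast h

/-- `E ^ k` starts in degree `k`, so the exponential series may be cut off. The bound `D` is left
free so that several coefficients can share one truncation. -/
theorem coeff_fexp {σ : Type*} {E : MvPowerSeries σ ℂ} (hE : constantCoeff E = 0)
    {m : σ →₀ ℕ} {D : ℕ} (h : m.degree ≤ D) :
    coeff m (fexp E) = ∑ k ∈ Finset.range (D + 1), (k ! : ℂ)⁻¹ * coeff m (E ^ k) := by
  rw [fexp, PowerSeries.coeff_subst (PowerSeries.HasSubst.of_constantCoeff_zero hE),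
    finsum_eq_sum_of_support_subset (s := Finset.range (D + 1))]
  · simp [PowerSeries.coeff_exp]
  · intro k hk
    by_contra hk'
    apply hk
    simp only [Finset.coe_range, Set.mem_Iio, not_lt] at hk'
    simp only
    rw [coeff_pow_eq_zero_of_degree_lt hE (by omega), smul_zero]

/-! ### Renaming the slots -/

/-- The renaming of the variables of a symbol induced by a permutation of the slots. -/
def renameSlots {n : ℕ} (ρ : Equiv.Perm (Fin (n + 1))) : Symb n →ₐ[ℂ] Symb n :=
  (renameEquiv ℂ (ρ.prodCongr (Equiv.refl SpVar))).toAlgHom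

theorem coeff_renameEquiv {σ : Type*} (e : Equiv.Perm σ) (x : σ →₀ ℕ)
    (F : MvPowerSeries σ ℂ) :
    coeff x (renameEquiv ℂ e F) = coeff (x.equivMapDomain e.symm) F := by
  rw [← coeff_embDomain_rename e.toEmbedding F (x.equivMapDomain e.symm)]
  have h : (x.equivMapDomain e.symm).embDomain e.toEmbedding = x := by
    refine Finsupp.ext fun i => ?_
    have := Finsupp.embDomain_apply_self e.toEmbedding (x.equivMapDomain e.symm) (e.symm i)
    simpa [Finsupp.equivMapDomain_apply] using this
  rw [h]
  rfl

theorem coeff_renameSlots {n : ℕ} (ρ : Equiv.Perm (Fin (n + 1))) (x : (Fin (n + 1) × SpVar) →₀ ℕ)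
    (F : Symb n) : coeff x (renameSlots ρ F) =
      coeff (x.equivMapDomain (ρ.prodCongr (Equiv.refl SpVar)).symm) F :=
  coeff_renameEquiv _ _ _

theorem constantCoeff_renameSlots {n : ℕ} (ρ : Equiv.Perm (Fin (n + 1))) (F : Symb n) :
    constantCoeff (renameSlots ρ F) = constantCoeff F := by
  rw [← coeff_zero_eq_constantCoeff_apply, coeff_renameSlots, ← coeff_zero_eq_constantCoeff_apply]
  congr 1

theorem renameSlots_X {n : ℕ} (ρ : Equiv.Perm (Fin (n + 1))) (k : Fin (n + 1)) (s : SpVar) :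
    renameSlots ρ (X (k, s)) = X (ρ k, s) :=
  rename_X _ _

theorem renameSlots_fexp {n : ℕ} (ρ : Equiv.Perm (Fin (n + 1))) {E : Symb n}
    (hE : constantCoeff E = 0) : renameSlots ρ (fexp E) = fexp (renameSlots ρ E) := by
  ext m
  rw [coeff_renameSlots]
  set m' := m.equivMapDomain (ρ.prodCongr (Equiv.refl SpVar)).symm with hm'
  -- A common truncation order for both sides avoids comparing the degrees of `m` and `m'`.
  rw [coeff_fexp hE (le_max_left m'.degree m.degree),
    coeff_fexp (by rwa [constantCoeff_renameSlots]) (le_max_right m'.degree m.degree)]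
  simp_rw [← map_pow, coeff_renameSlots, hm']

theorem renameSlots_slotY {n : ℕ} {ρ : Equiv.Perm (Fin (n + 1))} (h0 : ρ 0 = 0)
    (k : Fin (n + 1)) (α : Fin 2) : renameSlots ρ (slotY n k α) = slotY n (ρ k) α := by
  by_cases hk : k = 0
  · subst hk
    fin_cases α <;> simp [slotY, h0, renameSlots_X]
  · have : ρ k ≠ 0 := fun h => hk (ρ.injective (h.trans h0.symm))
    fin_cases α <;> simp [slotY, hk, this, renameSlots_X]

theorem renameSlots_slotYt {n : ℕ} {ρ : Equiv.Perm (Fin (n + 1))} (h0 : ρ 0 = 0)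
    (k : Fin (n + 1)) (α : Fin 2) : renameSlots ρ (slotYt n k α) = slotYt n (ρ k) α := by
  by_cases hk : k = 0
  · subst hk
    fin_cases α <;> simp [slotYt, h0, renameSlots_X]
  · have : ρ k ≠ 0 := fun h => hk (ρ.injective (h.trans h0.symm))
    fin_cases α <;> simp [slotYt, hk, this, renameSlots_X]

theorem map_ang {R S : Type*} [CommRing R] [CommRing S] (f : R →+* S) (a b : Fin 2 → R) :
    f (ang a b) = ang (fun α => f (a α)) (fun α => f (b α)) := by
  simp [ang]

theorem constantCoeff_slotY {n : ℕ} (k : Fin (n + 1)) (α : Fin 2) :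
    constantCoeff (slotY n k α) = 0 := by
  unfold slotY; split_ifs <;> fin_cases α <;> simp

theorem constantCoeff_slotYt {n : ℕ} (k : Fin (n + 1)) (α : Fin 2) :
    constantCoeff (slotYt n k α) = 0 := by
  unfold slotYt; split_ifs <;> fin_cases α <;> simp

theorem constantCoeff_ang {σ : Type*} {a b : Fin 2 → MvPowerSeries σ ℂ}
    (ha : ∀ α, constantCoeff (a α) = 0) : constantCoeff (ang a b) = 0 := by
  simp [ang, ha]

/-- A permutation of the slots that fixes the output slot permutes the arguments. -/
theorem exists_argument_perm {n : ℕ} {ρ : Equiv.Perm (Fin (n + 1))} (h0 : ρ 0 = 0) :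
    ∃ π : Equiv.Perm (Fin n), ∀ k : Fin n, ρ k.succ = (π k).succ := by
  have hne : ∀ k : Fin n, ρ k.succ ≠ 0 := fun k h =>
    Fin.succ_ne_zero k (ρ.injective (h.trans h0.symm))
  have hinj : Function.Injective fun k : Fin n => (ρ k.succ).pred (hne k) := fun k l h => by
    simpa using h
  exact ⟨Equiv.ofBijective _ (Finite.injective_iff_bijective.mp hinj), fun k => by simp⟩

/-- Relabelling the slots of an operator amounts to permuting its arguments: the sum over `K` is
reindexed. Slot `0` has to stay fixed because it carries the output. -/
theorem polyDiffPart_renameSlots {n : ℕ} {ρ : Equiv.Perm (Fin (n + 1))} (h0 : ρ 0 = 0)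
    {π : Equiv.Perm (Fin n)} (hπ : ∀ k : Fin n, ρ k.succ = (π k).succ)
    (F : Symb n) (Φ : Fin n → GF) (d : ℕ) :
    polyDiffPart (renameSlots ρ F) Φ d = polyDiffPart F (Φ ∘ π) d := by
  funext e
  let ε : Equiv.Perm (Fin n × SpVar) := π.prodCongr (Equiv.refl SpVar)
  have happ : ∀ (K : (Fin n × SpVar) →₀ ℕ) i s, K.equivMapDomain ε.symm (i, s) = K (π i, s) :=
    fun K i s => rfl
  refine Finset.sum_equiv (Finsupp.equivCongrLeft ε.symm) ?_ ?_
  · intro K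
    simp only [Finset.mem_finsuppAntidiag, Finset.subset_univ, and_true,
      Finsupp.equivCongrLeft_apply]
    have : ∑ q, K.equivMapDomain ε.symm q = ∑ q, K q := Equiv.sum_comp ε K
    rw [this]
  · intro K _
    simp only [Finsupp.equivCongrLeft_apply]
    congr 1
    · congr 1
      · rw [coeff_renameSlots]
        congr 2
        ext ⟨k, s⟩
        refine Fin.cases ?_ (fun k => ?_) k
        · simp [joinIdx, Finsupp.equivMapDomain_apply, h0]
        · simp [joinIdx, Finsupp.equivMapDomain_apply, hπ, happ]
      · exact (Equiv.prod_comp ε fun q => ((K q)! : ℂ)).symm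
    · exact (Equiv.prod_comp π fun i => coeff
        (Finsupp.equivFunOnFinite.symm fun s : SpVar => K (i, s)) (Φ i)).symm

theorem polyDiffPart_add {n : ℕ} (F G : Symb n) (Φ : Fin n → GF) (d : ℕ) :
    polyDiffPart (F + G) Φ d = polyDiffPart F Φ d + polyDiffPart G Φ d := by
  funext e
  change polyDiffPart (F + G) Φ d e = polyDiffPart F Φ d e + polyDiffPart G Φ d e
  simp only [polyDiffPart, map_add, add_mul, Finset.sum_add_distrib]

theorem polyDiffPart_smul {n : ℕ} (c : ℂ) (F : Symb n) (Φ : Fin n → GF) (d : ℕ) :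
    polyDiffPart (c • F) Φ d = c • polyDiffPart F Φ d := by
  funext e
  change polyDiffPart (c • F) Φ d e = c * polyDiffPart F Φ d e
  simp only [polyDiffPart, coeff_smul, mul_assoc, Finset.mul_sum]

/-- The part with `d` derivatives as a linear function of the symbol. -/
def polyDiffPartₗ {n : ℕ} (Φ : Fin n → GF) (d : ℕ) : Symb n →ₗ[ℂ] GF where
  toFun F := polyDiffPart F Φ d
  map_add' F G := polyDiffPart_add F G Φ d
  map_smul' c F := polyDiffPart_smul c F Φ d

/-! ### Contractions of dotted derivatives -/

/-- The derivative `λ̃^α̇ ∂̃_α̇`. -/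
def dotD (l : Fin 2 → ℂ) : Derivation ℂ GF GF :=
  l 0 • pderiv ℂ (Sum.inr 0) + l 1 • pderiv ℂ (Sum.inr 1)

/-- The ideal of the symbols all multiples of which act by zero on `Φ`. -/
def nullIdeal {n : ℕ} (Φ : Fin n → GF) : Ideal (Symb n) where
  carrier := {F | ∀ G d, polyDiffPart (G * F) Φ d = 0}
  add_mem' {F F'} h h' G d := by rw [mul_add, polyDiffPart_add, h, h', add_zero]
  zero_mem' G d := by rw [mul_zero]; exact (polyDiffPartₗ Φ d).map_zero
  smul_mem' c F h G d := by rw [smul_eq_mul, ← mul_assoc]; exact h _ d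

theorem polyDiffPart_eq_zero_of_coeff {n : ℕ} {F : Symb n} {Φ : Fin n → GF} {d : ℕ}
    {e : SpVar →₀ ℕ} (h : ∀ K ∈ Finset.finsuppAntidiag (Finset.univ : Finset (Fin n × SpVar)) d,
      coeff (joinIdx e K) F = 0) : polyDiffPart F Φ d e = 0 :=
  Finset.sum_eq_zero fun K hK => by rw [h K hK, zero_mul, zero_mul]

theorem coeff_mul_eq_zero_of_degree_le {σ : Type*} {F G : MvPowerSeries σ ℂ} {D : ℕ}
    (h : ∀ m : σ →₀ ℕ, m.degree ≤ D → coeff m F = 0) {m : σ →₀ ℕ} (hm : m.degree ≤ D) :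
    coeff m (G * F) = 0 := by
  classical
  rw [coeff_mul]
  refine Finset.sum_eq_zero fun p hp => ?_
  rw [Finset.HasAntidiagonal.mem_antidiagonal] at hp
  rw [h, mul_zero]
  rw [← hp, map_add] at hm
  omega

/-- For fixed `d` and output index `e` only finitely many coefficients of the symbol matter. Up to
their maximal degree the exponentials agree with polynomials, and `B` divides `(A + B) ^ k - A ^ k`.
-/
theorem fexp_add_sub_mem_nullIdeal {n : ℕ} {Φ : Fin n → GF} {A B : Symb n}
    (hA : constantCoeff A = 0) (hB : constantCoeff B = 0) (h : B ∈ nullIdeal Φ) :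
    fexp (A + B) - fexp A ∈ nullIdeal Φ := by
  intro G d
  funext e
  obtain ⟨D, hD⟩ : ∃ D, ∀ K ∈ Finset.finsuppAntidiag (Finset.univ : Finset (Fin n × SpVar)) d,
      (joinIdx e K).degree ≤ D :=
    ⟨_, fun K hK => Finset.le_sup (f := fun K => (joinIdx e K).degree) hK⟩
  set S : Symb n := ∑ k ∈ Finset.range (D + 1), (k ! : ℂ)⁻¹ • ((A + B) ^ k - A ^ k) with hS
  have hSmem : S ∈ nullIdeal Φ := by
    refine Ideal.sum_mem _ fun k _ => ?_
    rw [smul_eq_C_mul]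
    refine Ideal.mul_mem_left _ _ ?_
    obtain ⟨Q, hQ⟩ := sub_dvd_pow_sub_pow (A + B) A k
    rw [hQ, add_sub_cancel_left]
    exact Ideal.mul_mem_right _ _ h
  have hsplit : G * (fexp (A + B) - fexp A) = G * (fexp (A + B) - fexp A - S) + G * S := by ring
  rw [hsplit, polyDiffPart_add, hSmem G d, add_zero]
  refine polyDiffPart_eq_zero_of_coeff fun K hK =>
    coeff_mul_eq_zero_of_degree_le (D := D) (fun m hm => ?_) (hD K hK)
  rw [map_sub, map_sub, coeff_fexp (by simp [hA, hB]) hm, coeff_fexp hA hm, hS, map_sum,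
    ← Finset.sum_sub_distrib, ← Finset.sum_sub_distrib]
  refine Finset.sum_eq_zero fun k _ => ?_
  rw [coeff_smul, map_sub, mul_sub, sub_self]

/-- The relation between neighbouring derivatives at the origin for a function annihilated by
`λ̃^α̇ ∂̃_α̇`. -/
theorem coeff_of_dotD_eq_zero {l : Fin 2 → ℂ} {f : GF} (hf : dotD l f = 0) (m : SpVar →₀ ℕ) :
    l 0 * ((m (Sum.inr 0) + 1) * coeff (m + Finsupp.single (Sum.inr 0) 1) f) +
      l 1 * ((m (Sum.inr 1) + 1) * coeff (m + Finsupp.single (Sum.inr 1) 1) f) = 0 := by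
  have := congrArg (coeff m) hf
  simp only [dotD, Derivation.add_apply, Derivation.smul_apply, map_add, coeff_smul,
    coeff_pderiv, map_zero] at this
  linear_combination this

/-- The derivatives at the origin of the arguments, `∂^K Φ |_0 = K! · coeff_K Φ`. -/
def jetWeight {n : ℕ} (Φ : Fin n → GF) (K : (Fin n × SpVar) →₀ ℕ) : ℂ :=
  (∏ q, ((K q)! : ℂ)) * ∏ i, coeff (Finsupp.equivFunOnFinite.symm fun s : SpVar => K (i, s)) (Φ i)

theorem jetWeight_eq_prod {n : ℕ} (Φ : Fin n → GF) (K : (Fin n × SpVar) →₀ ℕ) :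
    jetWeight Φ K = ∏ i, (∏ s, ((K (i, s))! : ℂ)) *
      coeff (Finsupp.equivFunOnFinite.symm fun s : SpVar => K (i, s)) (Φ i) := by
  rw [jetWeight, Fintype.prod_prod_type, Finset.prod_mul_distrib]

/-- Raising one exponent multiplies the factorials by `K (i, s) + 1`, the same factor that `pderiv`
produces. Hence a differential equation for `Φ i` becomes a linear relation with constant
coefficients between jet weights. -/
theorem jetWeight_add_single {n : ℕ} (Φ : Fin n → GF) (K : (Fin n × SpVar) →₀ ℕ) (i : Fin n)
    (s : SpVar) : jetWeight Φ (K + Finsupp.single (i, s) 1) =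
      (∏ t, ((K (i, t))! : ℂ)) * ((K (i, s) + 1) * coeff
        ((Finsupp.equivFunOnFinite.symm fun t : SpVar => K (i, t)) + Finsupp.single s 1) (Φ i)) *
      ∏ j ∈ Finset.univ.erase i, (∏ t, ((K (j, t))! : ℂ)) *
        coeff (Finsupp.equivFunOnFinite.symm fun t : SpVar => K (j, t)) (Φ j) := by
  rw [jetWeight_eq_prod, ← Finset.mul_prod_erase _ _ (Finset.mem_univ i)]
  congr 1
  · have h1 : (Finsupp.equivFunOnFinite.symm fun t : SpVar =>
        (K + Finsupp.single (i, s) 1 : (Fin n × SpVar) →₀ ℕ) (i, t)) =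
        (Finsupp.equivFunOnFinite.symm fun t : SpVar => K (i, t)) + Finsupp.single s 1 := by
      refine Finsupp.ext fun t => ?_
      simp [Finsupp.single_apply]
    have h2 : ∏ t, (((K + Finsupp.single (i, s) 1 : (Fin n × SpVar) →₀ ℕ) (i, t))! : ℂ) =
        (∏ t, ((K (i, t))! : ℂ)) * (K (i, s) + 1) := by
      rw [← Finset.mul_prod_erase _ _ (Finset.mem_univ s),
        ← Finset.mul_prod_erase _ (fun t => ((K (i, t))! : ℂ)) (Finset.mem_univ s)]
      have h3 : ∏ t ∈ Finset.univ.erase s, (((K + Finsupp.single (i, s) 1 : (Fin n × SpVar) →₀ ℕ) (i, t))! : ℂ) =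
          ∏ t ∈ Finset.univ.erase s, ((K (i, t))! : ℂ) := by
        refine Finset.prod_congr rfl fun t ht => ?_
        have : s ≠ t := (Finset.ne_of_mem_erase ht).symm
        simp [this]
      rw [h3]
      simp only [Finsupp.add_apply, Finsupp.single_eq_same, Nat.factorial_succ]
      push_cast
      ring
    rw [h1, h2, mul_assoc]
  · refine Finset.prod_congr rfl fun j hj => ?_
    have hji : i ≠ j := (Finset.ne_of_mem_erase hj).symm
    simp [hji]

theorem jetWeight_relation {n : ℕ} {Φ : Fin n → GF} {l : Fin 2 → ℂ} (h : ∀ i, dotD l (Φ i) = 0)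
    (K : (Fin n × SpVar) →₀ ℕ) (i : Fin n) :
    l 0 * jetWeight Φ (K + Finsupp.single (i, Sum.inr 0) 1) +
      l 1 * jetWeight Φ (K + Finsupp.single (i, Sum.inr 1) 1) = 0 := by
  rw [jetWeight_add_single, jetWeight_add_single]
  have := coeff_of_dotD_eq_zero (h i) (Finsupp.equivFunOnFinite.symm fun t : SpVar => K (i, t))
  simp only [Finsupp.equivFunOnFinite_symm_apply_apply] at this
  linear_combination ((∏ t, ((K (i, t))! : ℂ)) * ∏ j ∈ Finset.univ.erase i,
    (∏ t, ((K (j, t))! : ℂ)) *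
      coeff (Finsupp.equivFunOnFinite.symm fun t : SpVar => K (j, t)) (Φ j)) * this

/-- The symmetry of the derivatives that makes the contraction `[∂_i ∂_j]` vanish. -/
theorem jetWeight_exchange {n : ℕ} {Φ : Fin n → GF} {l : Fin 2 → ℂ} (hl : l ≠ 0)
    (h : ∀ i, dotD l (Φ i) = 0) (K : (Fin n × SpVar) →₀ ℕ) (i j : Fin n) :
    jetWeight Φ (K + (Finsupp.single (i, Sum.inr 0) 1 + Finsupp.single (j, Sum.inr 1) 1)) =
      jetWeight Φ (K + (Finsupp.single (i, Sum.inr 1) 1 + Finsupp.single (j, Sum.inr 0) 1)) := by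
  -- `h1` and `h2` share the term with both derivatives along component `1`, `h3` and `h4` the one
  -- along component `0`. Eliminating it gives the claim times `l 0`, respectively times `l 1`, and
  -- one of these is nonzero.
  have h1 := jetWeight_relation h (K + Finsupp.single (j, Sum.inr 1) 1) i
  have h2 := jetWeight_relation h (K + Finsupp.single (i, Sum.inr 1) 1) j
  have h3 := jetWeight_relation h (K + Finsupp.single (j, Sum.inr 0) 1) i
  have h4 := jetWeight_relation h (K + Finsupp.single (i, Sum.inr 0) 1) j
  have e1 : ∀ a b : (Fin n × SpVar) →₀ ℕ, K + a + b = K + (a + b) := fun a b => add_assoc _ _ _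
  have e2 : ∀ a b : (Fin n × SpVar) →₀ ℕ, K + a + b = K + (b + a) := fun a b => by
    rw [add_assoc, add_comm a b]
  rw [e2, e2] at h1 h3
  rw [e1, e1] at h2 h4
  by_cases hl0 : l 0 = 0
  · have hl1 : l 1 ≠ 0 := fun hl1 => hl (funext fun α => by fin_cases α <;> assumption)
    exact mul_left_cancel₀ hl1 (by linear_combination h4 - h3)
  · exact mul_left_cancel₀ hl0 (by linear_combination h1 - h2)

theorem coeff_joinIdx_monomial_mul {n : ℕ} (e : SpVar →₀ ℕ) (k K : (Fin n × SpVar) →₀ ℕ)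
    (G : Symb n) : coeff (joinIdx e K) (monomial (joinIdx 0 k) 1 * G) =
      if k ≤ K then coeff (joinIdx e (K - k)) G else 0 := by
  rw [coeff_monomial_mul, one_mul]
  have hle : joinIdx 0 k ≤ joinIdx e K ↔ k ≤ K := by
    refine ⟨fun h q => by simpa [joinIdx] using h (q.1.succ, q.2), fun h q => ?_⟩
    obtain ⟨i, s⟩ := q
    refine Fin.cases ?_ (fun i => ?_) i
    · simp [joinIdx]
    · simpa [joinIdx] using h (i, s)
  have hsub : joinIdx e K - joinIdx 0 k = joinIdx e (K - k) := by
    refine Finsupp.ext fun q => ?_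
    obtain ⟨i, s⟩ := q
    refine Fin.cases ?_ (fun i => ?_) i <;> simp [joinIdx]
  simp only [hle, hsub]

/-- A monomial factor shifts the summation index. Since both monomials contain equally many
derivatives, `K ↦ K - k + k'` preserves the part with `d` derivatives, and by `h` also the jet
weight. -/
theorem polyDiffPart_monomial_mul_congr {n : ℕ} {Φ : Fin n → GF} {k k' : (Fin n × SpVar) →₀ ℕ}
    (hdeg : ∑ q, k q = ∑ q, k' q) (h : ∀ K, jetWeight Φ (K + k) = jetWeight Φ (K + k'))
    (G : Symb n) (d : ℕ) : polyDiffPart (monomial (joinIdx 0 k) 1 * G) Φ d =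
      polyDiffPart (monomial (joinIdx 0 k') 1 * G) Φ d := by
  funext e
  simp only [polyDiffPart, mul_assoc, coeff_joinIdx_monomial_mul, ite_mul, zero_mul]
  rw [← Finset.sum_filter, ← Finset.sum_filter]
  have hmem : ∀ {k k' : (Fin n × SpVar) →₀ ℕ}, ∑ q, k q = ∑ q, k' q →
      ∀ K ∈ (Finset.finsuppAntidiag (Finset.univ : Finset (Fin n × SpVar)) d).filter (k ≤ ·),
      K - k + k' ∈
        (Finset.finsuppAntidiag (Finset.univ : Finset (Fin n × SpVar)) d).filter (k' ≤ ·) := by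
    intro k k' hdeg K hK
    simp only [Finset.mem_filter, Finset.mem_finsuppAntidiag, Finset.subset_univ,
      and_true] at hK ⊢
    refine ⟨?_, le_add_self⟩
    have hK' : K - k + k = K := tsub_add_cancel_of_le hK.2
    rw [← hK.1]
    conv_rhs => rw [← hK']
    change ∑ q, (K - k + k') q = ∑ q, (K - k + k) q
    simp only [Finsupp.add_apply, Finset.sum_add_distrib, hdeg]
  refine Finset.sum_nbij' (fun K => K - k + k') (fun K => K - k' + k) (hmem hdeg)
    (hmem hdeg.symm) ?_ ?_ ?_
  · intro K hK
    replace hK := (Finset.mem_filter.mp hK).2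
    simp [tsub_add_cancel_of_le hK]
  · intro K hK
    replace hK := (Finset.mem_filter.mp hK).2
    simp [tsub_add_cancel_of_le hK]
  · intro K hK
    replace hK := (Finset.mem_filter.mp hK).2
    have := h (K - k)
    rw [tsub_add_cancel_of_le hK] at this
    change _ * jetWeight Φ K = _ * jetWeight Φ (K - k + k')
    rw [this, add_tsub_cancel_right]

theorem ang_slotYt_mem_nullIdeal {n : ℕ} {Φ : Fin n → GF} {l : Fin 2 → ℂ} (hl : l ≠ 0)
    (h : ∀ i, dotD l (Φ i) = 0) (i j : Fin n) :
    ang (slotYt n i.succ) (slotYt n j.succ) ∈ nullIdeal Φ := by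
  intro G d
  have hX : ∀ s t : SpVar, (X (i.succ, s) * X (j.succ, t) : Symb n) =
      monomial (joinIdx 0 (Finsupp.single (i, s) 1 + Finsupp.single (j, t) 1)) 1 := by
    intro s t
    rw [X_def, X_def, monomial_mul_monomial, one_mul]
    refine congrArg (fun z => monomial z (1 : ℂ)) (Finsupp.ext fun q => ?_)
    obtain ⟨k, r⟩ := q
    refine Fin.cases ?_ (fun k => ?_) k
    · simp [joinIdx, Finsupp.single_apply, Fin.succ_ne_zero]
    · simp [joinIdx, Finsupp.single_apply]
  have hang : G * ang (slotYt n i.succ) (slotYt n j.succ) =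
      X (i.succ, Sum.inr 1) * X (j.succ, Sum.inr 0) * G +
        (-1 : ℂ) • (X (i.succ, Sum.inr 0) * X (j.succ, Sum.inr 1) * G) := by
    simp only [ang, slotYt, Fin.succ_ne_zero, if_false, Matrix.cons_val_zero, Matrix.cons_val_one,
      neg_smul, one_smul]
    ring
  rw [hang, polyDiffPart_add, polyDiffPart_smul, hX, hX,
    polyDiffPart_monomial_mul_congr ?_ fun K => jetWeight_exchange hl h K i j]
  · rw [neg_smul, one_smul, add_neg_cancel]
  · simp [Finset.sum_add_distrib]

/-- The part of `mho` without contractions between the arguments. -/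
def mhoOutput (n : ℕ) : Symb n :=
  fexp (∑ i : Fin n, ang (slotYt n 0) (slotYt n i.succ))

theorem constantCoeff_sum_ang_slotYt (n : ℕ) :
    constantCoeff (∑ i : Fin n, ang (slotYt n 0) (slotYt n i.succ)) = 0 := by
  rw [map_sum]
  exact Finset.sum_eq_zero fun i _ => constantCoeff_ang (constantCoeff_slotYt 0)

theorem polyDiffPart_mho_mul {n : ℕ} {Φ : Fin n → GF} {l : Fin 2 → ℂ} (hl : l ≠ 0)
    (h : ∀ i, dotD l (Φ i) = 0) (F : Symb n) (d : ℕ) :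
    polyDiffPart (mho n * F) Φ d = polyDiffPart (mhoOutput n * F) Φ d := by
  have hmem : mho n - mhoOutput n ∈ nullIdeal Φ := by
    refine fexp_add_sub_mem_nullIdeal (constantCoeff_sum_ang_slotYt n) ?_ ?_
    · simp only [map_sum]
      refine Finset.sum_eq_zero fun i _ => Finset.sum_eq_zero fun j _ => ?_
      split_ifs
      · exact constantCoeff_ang (constantCoeff_slotYt _)
      · exact map_zero _
    · refine Ideal.sum_mem _ fun i _ => Ideal.sum_mem _ fun j _ => ?_
      split_ifs
      · exact ang_slotYt_mem_nullIdeal hl h i j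
      · exact Ideal.zero_mem _
  have hsplit : mho n * F = mhoOutput n * F + F * (mho n - mhoOutput n) := by ring
  rw [hsplit, polyDiffPart_add, hmem F d, add_zero]

/-- The surviving exponent is a plain sum over the arguments. For `mho` this symmetry fails: its
contractions are antisymmetric and ordered by `i < j`. -/
theorem renameSlots_mhoOutput {n : ℕ} {ρ : Equiv.Perm (Fin (n + 1))} (h0 : ρ 0 = 0) :
    renameSlots ρ (mhoOutput n) = mhoOutput n := by
  obtain ⟨π, hπ⟩ := exists_argument_perm h0
  rw [mhoOutput, renameSlots_fexp ρ (constantCoeff_sum_ang_slotYt n), map_sum]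
  congr 1
  rw [← Equiv.sum_comp π fun i => ang (slotYt n 0) (slotYt n i.succ)]
  refine Finset.sum_congr rfl fun i _ => ?_
  have := map_ang (renameSlots ρ).toRingHom (slotYt n 0) (slotYt n i.succ)
  refine this.trans ?_
  congr 1 <;> funext α
  · exact (renameSlots_slotYt h0 0 α).trans (by rw [h0])
  · exact (renameSlots_slotYt h0 i.succ α).trans (by rw [hπ])

/-! ### The fields depend on the dotted variables through `[y λ]` only -/

theorem dotD_apply (l : Fin 2 → ℂ) (f : GF) :
    dotD l f = l 0 • pderiv ℂ (Sum.inr 0) f + l 1 • pderiv ℂ (Sum.inr 1) f := rfl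

theorem dotD_X_inl (l : Fin 2 → ℂ) (α : Fin 2) : dotD l (X (Sum.inl α)) = 0 := by
  rw [dotD_apply, pderiv_X_of_ne (by simp), pderiv_X_of_ne (by simp), smul_zero, smul_zero,
    add_zero]

theorem dotD_X_inr (l : Fin 2 → ℂ) (α : Fin 2) : dotD l (X (Sum.inr α)) = C (l α) := by
  rw [dotD_apply, smul_eq_C_mul, smul_eq_C_mul]
  fin_cases α
  · simp only [Fin.zero_eta, pderiv_X_self]
    rw [pderiv_X_of_ne (by simp)]
    simp
  · simp only [Fin.mk_one, pderiv_X_self]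
    rw [pderiv_X_of_ne (by simp)]
    simp

theorem dotD_C (l : Fin 2 → ℂ) (c : ℂ) : dotD l (C c) = 0 := by
  rw [dotD_apply, pderiv_C, pderiv_C, smul_zero, smul_zero, add_zero]

theorem dotD_mul_eq_zero {l : Fin 2 → ℂ} {f g : GF} (hf : dotD l f = 0) (hg : dotD l g = 0) :
    dotD l (f * g) = 0 := by
  rw [Derivation.leibniz, hf, hg, smul_zero, smul_zero, add_zero]

theorem dotD_pow_eq_zero {l : Fin 2 → ℂ} {f : GF} (hf : dotD l f = 0) (k : ℕ) :
    dotD l (f ^ k) = 0 := by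
  rw [Derivation.leibniz_pow, hf, smul_zero, smul_zero]

theorem dotD_smul_eq_zero {l : Fin 2 → ℂ} {f : GF} (hf : dotD l f = 0) (c : ℂ) :
    dotD l (c • f) = 0 := by
  rw [Derivation.map_smul, hf, smul_zero]

theorem dotD_sum_eq_zero {l : Fin 2 → ℂ} {ι : Type*} {s : Finset ι} {f : ι → GF}
    (hf : ∀ i ∈ s, dotD l (f i) = 0) : dotD l (∑ i ∈ s, f i) = 0 := by
  rw [map_sum]
  exact Finset.sum_eq_zero hf

theorem dotD_brY (l a : Fin 2 → ℂ) : dotD l (brY a) = 0 := by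
  rw [brY, ang, map_sub]
  simp only [Matrix.cons_val_zero, Matrix.cons_val_one]
  rw [dotD_mul_eq_zero (dotD_X_inl l 1) (dotD_C l _),
    dotD_mul_eq_zero (dotD_X_inl l 0) (dotD_C l _), sub_zero]

theorem dotD_brYt (l : Fin 2 → ℂ) : dotD l (brYt l) = 0 := by
  rw [brYt, ang, map_sub]
  simp only [Matrix.cons_val_zero, Matrix.cons_val_one, Derivation.leibniz, dotD_C, dotD_X_inr,
    smul_eq_mul]
  ring

/-- A coefficient of the derivative in degree `m.degree` involves coefficients of degree `m.degree +
1` only, hence the same finite partial sum for both dotted variables. -/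
theorem dotD_formalSum_eq_zero {l : Fin 2 → ℂ} {f : ℕ → GF} (hf : ∀ k, dotD l (f k) = 0) :
    dotD l (formalSum f) = 0 := by
  ext m
  have hcoeff : ∀ g : GF, coeff m (dotD l g) =
      l 0 * (coeff (m + Finsupp.single (Sum.inr 0) 1) g * (m (Sum.inr 0) + 1)) +
        l 1 * (coeff (m + Finsupp.single (Sum.inr 1) 1) g * (m (Sum.inr 1) + 1)) := fun g => by
    rw [dotD_apply, map_add, coeff_smul, coeff_smul, coeff_pderiv, coeff_pderiv]
  have hsum : ∀ i : SpVar, coeff (m + Finsupp.single i 1) (formalSum f) =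
      ∑ k ∈ Finset.range (m.degree + 1 + 1), coeff (m + Finsupp.single i 1) (f k) := fun i => by
    change ∑ k ∈ Finset.range ((m + Finsupp.single i 1).degree + 1), _ = _
    rw [map_add, Finsupp.degree_single]
  rw [map_zero, hcoeff, hsum, hsum, Finset.sum_mul, Finset.sum_mul, Finset.mul_sum,
    Finset.mul_sum, ← Finset.sum_add_distrib]
  exact Finset.sum_eq_zero fun k _ => by rw [← hcoeff, hf, map_zero]

theorem dotD_omegaField (lam lamd mud : Fin 2 → ℂ) (H : ℕ → Spacetime → ℂ) (x ξ : Spacetime) :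
    dotD lamd (omegaField lam lamd mud H x ξ) = 0 := by
  refine dotD_smul_eq_zero (dotD_formalSum_eq_zero fun t => dotD_smul_eq_zero
    (dotD_sum_eq_zero fun k _ => dotD_smul_eq_zero ?_ _) _) _
  exact dotD_mul_eq_zero (dotD_pow_eq_zero (dotD_brY _ _) _) (dotD_pow_eq_zero (dotD_brYt _) _)

theorem dotD_homPart (l : Fin 2 → ℂ) (f : MvPowerSeries (Fin 2) ℂ) (k : ℕ) :
    dotD l (homPart f k) = 0 :=
  dotD_sum_eq_zero fun _ _ => dotD_smul_eq_zero (dotD_mul_eq_zero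
    (dotD_pow_eq_zero (dotD_X_inl l 0) _) (dotD_pow_eq_zero (dotD_X_inl l 1) _)) _

theorem dotD_CSpin (lam lamd : Fin 2 → ℂ) (h : MvPowerSeries (Fin 2) ℂ) (s : ℕ) :
    dotD lamd (CSpin lam lamd h s) = 0 :=
  dotD_formalSum_eq_zero fun _ => dotD_smul_eq_zero
    (dotD_mul_eq_zero (dotD_pow_eq_zero (dotD_brYt _) _) (dotD_homPart _ _ _)) _

theorem IsBSpin.dotD_eq_zero {lam lamd mu : Fin 2 → ℂ} {c : ℂ} {s : ℕ} {B : GF}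
    (h : IsBSpin lam lamd mu c s B) : dotD lamd B = 0 := by
  obtain ⟨β, -, rfl⟩ := h
  exact dotD_formalSum_eq_zero fun m => dotD_sum_eq_zero fun ab _ => dotD_smul_eq_zero
    (dotD_mul_eq_zero (dotD_mul_eq_zero (dotD_pow_eq_zero (dotD_brY _ _) _)
      (dotD_pow_eq_zero (dotD_brY _ _) _)) (dotD_pow_eq_zero (dotD_brYt _) _)) _

theorem dotD_zeroFormField {lam lamd mu mud : Fin 2 → ℂ} {H ψ : ℕ → Spacetime → ℂ}
    {B : ℕ → Spacetime → GF} {x : Spacetime}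
    (hB : ∀ s, IsBSpin lam lamd mu (ψ s x) s (B s x)) :
    dotD lamd (zeroFormField lam lamd mud H B x) = 0 := by
  rw [zeroFormField, map_add, dotD_formalSum_eq_zero fun t => dotD_CSpin _ _ _ _,
    dotD_formalSum_eq_zero fun s => (hB s).dotD_eq_zero, add_zero]

/-! ### Counting graphs -/

section Graphs

variable {N : ℕ} {i j : Fin (N + 3)}

theorem IsGraph.exists_eq (hij : i < j) {τ : Fin (N + 1) → Fin (N + 3)} (h : IsGraph i j τ)
    {k : Fin (N + 3)} (hki : k ≠ i) (hkj : k ≠ j) : ∃ r, τ r = k := by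
  have himage : Finset.univ.image τ = {i, j}ᶜ := by
    refine Finset.eq_of_subset_of_card_le ?_ ?_
    · intro k hk
      obtain ⟨r, -, rfl⟩ := Finset.mem_image.mp hk
      simpa using h.2.1 r
    · rw [Finset.card_image_of_injective _ h.1, Finset.card_compl, Finset.card_pair hij.ne]
      simp
  have : k ∈ Finset.univ.image τ := by rw [himage]; simp [hki, hkj]
  simpa using this

/-- The places of the line at which the slots between `i` and `j` are attached. -/
def innerPlaces (i j : Fin (N + 3)) (τ : Fin (N + 1) → Fin (N + 3)) : Finset (Fin (N + 1)) :=
  Finset.univ.filter fun r => i < τ r ∧ τ r < j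

theorem card_innerPlaces (hij : i < j) {τ : Fin (N + 1) → Fin (N + 3)} (h : IsGraph i j τ) :
    (innerPlaces i j τ).card = j.val - i.val - 1 := by
  rw [← Fin.card_Ioo, ← Finset.card_image_of_injective _ h.1]
  congr 1
  ext k
  simp only [innerPlaces, Finset.mem_image, Finset.mem_filter, Finset.mem_univ, true_and,
    Finset.mem_Ioo]
  constructor
  · rintro ⟨r, hr, rfl⟩
    exact hr
  · intro hk
    obtain ⟨r, rfl⟩ := h.exists_eq hij hk.1.ne' hk.2.ne
    exact ⟨r, hk, rfl⟩

/-- Once it is known which arc supplies the leaf at each place, the leaf must be the first unused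
slot of that arc. So the two graphs agree place by place. -/
theorem IsGraph.eq_of_innerPlaces_eq (hij : i < j) {τ τ' : Fin (N + 1) → Fin (N + 3)}
    (h : IsGraph i j τ) (h' : IsGraph i j τ') (heq : innerPlaces i j τ = innerPlaces i j τ') :
    τ = τ' := by
  have hiff : ∀ r, (i < τ r ∧ τ r < j) ↔ (i < τ' r ∧ τ' r < j) := fun r => by
    simpa [innerPlaces] using Finset.ext_iff.mp heq r
  -- The slot `τ r` occurs in `τ'` at some place `s`, and `s < r` would contradict injectivity of
  -- `τ`. So `r ≤ s`, and monotonicity of `τ'` along the arc bounds the distance of `τ' r` from `j`.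
  -- Exchanging the graphs gives the reverse bound.
  have key : ∀ {τ τ' : Fin (N + 1) → Fin (N + 3)}, IsGraph i j τ → IsGraph i j τ' →
      (∀ r, (i < τ r ∧ τ r < j) ↔ (i < τ' r ∧ τ' r < j)) → ∀ r, (∀ s < r, τ s = τ' s) →
      ((i < τ r ∧ τ r < j) → j - τ' r ≤ j - τ r) ∧
        (¬ (i < τ r ∧ τ r < j) → τ' r - j ≤ τ r - j) := by
    intro τ τ' h h' hiff r hr
    obtain ⟨s, hs⟩ := h'.exists_eq hij (h.2.1 r).1 (h.2.1 r).2
    have hsr : ¬ s < r := fun hlt => hlt.ne (h.1 ((hr s hlt).trans hs))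
    rcases (not_lt.mp hsr).eq_or_lt with rfl | hlt
    · rw [hs]; exact ⟨fun _ => le_rfl, fun _ => le_rfl⟩
    · constructor
      · intro hin
        have := (h'.2.2 r s hlt).1 ((hiff r).mp hin) (by rwa [hs])
        rw [hs] at this
        exact this.le
      · intro hout
        have := (h'.2.2 r s hlt).2 (fun hc => hout ((hiff r).mpr hc)) (by rwa [hs])
        rw [hs] at this
        exact this.le
  funext r
  induction r using WellFoundedLT.induction with
  | ind r ih =>
    have h1 := key h h' hiff r ih
    have h2 := key h' h (fun r => (hiff r).symm) r fun s hs => (ih s hs).symm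
    by_cases hin : i < τ r ∧ τ r < j
    · exact sub_right_injective (le_antisymm (h2.1 ((hiff r).mp hin)) (h1.1 hin))
    · exact sub_left_injective
        (le_antisymm (h2.2 fun hc => hin ((hiff r).mpr hc)) (h1.2 hin))

/-- The number of elements of a set of places before a given place. -/
def placesBefore (A : Finset (Fin (N + 1))) (r : Fin (N + 1)) : ℕ := (A.filter (· < r)).card

theorem placesBefore_lt {A : Finset (Fin (N + 1))} {r : Fin (N + 1)} (hr : r ∈ A) :
    placesBefore A r < A.card := by
  refine Finset.card_lt_card ⟨Finset.filter_subset _ _, fun h => ?_⟩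
  simpa using h hr

theorem placesBefore_strictMono {A : Finset (Fin (N + 1))} {r s : Fin (N + 1)} (hr : r ∈ A)
    (hrs : r < s) : placesBefore A r < placesBefore A s := by
  refine Finset.card_lt_card ⟨fun t ht => ?_, fun h => ?_⟩
  · simp only [Finset.mem_filter] at ht ⊢
    exact ⟨ht.1, ht.2.trans hrs⟩
  · have := h (Finset.mem_filter.mpr ⟨hr, hrs⟩)
    simp at this

/-- The graph whose slots between `i` and `j` are attached at the places `A`. -/
def graphOf (j : Fin (N + 3)) (A : Finset (Fin (N + 1))) (r : Fin (N + 1)) : Fin (N + 3) :=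
  if r ∈ A then j - Fin.ofNat (N + 3) (placesBefore A r + 1)
  else j + Fin.ofNat (N + 3) (placesBefore Aᶜ r + 1)

/-- Places are counted from `0` but distances from `j` start at `1`. The inner arc has `j - i - 1`
slots, so the subtraction does not wrap around. -/
theorem graphOf_of_mem {A : Finset (Fin (N + 1))} (hij : i < j)
    (hA : A.card = j.val - i.val - 1) {r : Fin (N + 1)} (hr : r ∈ A) :
    (graphOf j A r).val = j.val - (placesBefore A r + 1) ∧
      (j - graphOf j A r).val = placesBefore A r + 1 := by
  have hlt := placesBefore_lt hr
  have hval : (Fin.ofNat (N + 3) (placesBefore A r + 1)).val = placesBefore A r + 1 := by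
    rw [Fin.val_ofNat]; exact Nat.mod_eq_of_lt (by omega)
  constructor
  · rw [graphOf, if_pos hr, Fin.sub_val_of_le, hval]
    rw [Fin.le_def, hval]; omega
  · rw [graphOf, if_pos hr, sub_sub_cancel, hval]

/-- The outer arc may pass through slot `0`, whence the two alternatives. The last inequality says
that it stops before reaching `i`. -/
theorem graphOf_of_notMem {A : Finset (Fin (N + 1))} (hij : i < j)
    (hA : A.card = j.val - i.val - 1) {r : Fin (N + 1)} (hr : r ∉ A) :
    ((graphOf j A r).val = j.val + (placesBefore Aᶜ r + 1) ∨
      (graphOf j A r).val + (N + 3) = j.val + (placesBefore Aᶜ r + 1)) ∧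
      (graphOf j A r - j).val = placesBefore Aᶜ r + 1 ∧
      j.val + (placesBefore Aᶜ r + 1) < i.val + (N + 3) := by
  have hlt := placesBefore_lt (Finset.mem_compl.mpr hr)
  have hcard : Aᶜ.card = N + 1 - A.card := by simp [Finset.card_compl]
  have hval : (Fin.ofNat (N + 3) (placesBefore Aᶜ r + 1)).val = placesBefore Aᶜ r + 1 := by
    rw [Fin.val_ofNat]; exact Nat.mod_eq_of_lt (by omega)
  refine ⟨?_, ?_, by omega⟩
  · rw [graphOf, if_neg hr, Fin.val_add_eq_ite, hval]
    split_ifs <;> omega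
  · rw [graphOf, if_neg hr, add_sub_cancel_left, hval]

theorem graphOf_inner_iff {A : Finset (Fin (N + 1))} (hij : i < j)
    (hA : A.card = j.val - i.val - 1) (r : Fin (N + 1)) :
    (i < graphOf j A r ∧ graphOf j A r < j) ↔ r ∈ A := by
  by_cases hr : r ∈ A
  · have h1 := graphOf_of_mem hij hA hr
    have h2 := placesBefore_lt hr
    simp only [Fin.lt_def, hr, iff_true]
    omega
  · have h1 := graphOf_of_notMem hij hA hr
    simp only [Fin.lt_def, hr, iff_false]
    omega

theorem isGraph_graphOf {A : Finset (Fin (N + 1))} (hij : i < j)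
    (hA : A.card = j.val - i.val - 1) : IsGraph i j (graphOf j A) := by
  have hord : ∀ r r', r < r' →
      (r ∈ A → r' ∈ A → j - graphOf j A r < j - graphOf j A r') ∧
      (r ∉ A → r' ∉ A → graphOf j A r - j < graphOf j A r' - j) := by
    intro r r' hrr'
    constructor
    · intro hr hr'
      rw [Fin.lt_def, (graphOf_of_mem hij hA hr).2, (graphOf_of_mem hij hA hr').2]
      exact Nat.succ_lt_succ (placesBefore_strictMono hr hrr')
    · intro hr hr'
      rw [Fin.lt_def, (graphOf_of_notMem hij hA hr).2.1, (graphOf_of_notMem hij hA hr').2.1]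
      exact Nat.succ_lt_succ (placesBefore_strictMono (Finset.mem_compl.mpr hr) hrr')
  have hne : ∀ r r', r < r' → graphOf j A r ≠ graphOf j A r' := by
    intro r r' hrr' heq
    have hiff : r ∈ A ↔ r' ∈ A := by
      rw [← graphOf_inner_iff hij hA, ← graphOf_inner_iff hij hA, heq]
    by_cases hr : r ∈ A
    · have := (hord r r' hrr').1 hr (hiff.mp hr)
      rw [heq] at this
      exact lt_irrefl _ this
    · have := (hord r r' hrr').2 hr fun h => hr (hiff.mpr h)
      rw [heq] at this
      exact lt_irrefl _ this
  refine ⟨?_, ?_, ?_⟩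
  · intro r r' heq
    rcases lt_trichotomy r r' with h | h | h
    · exact absurd heq (hne r r' h)
    · exact h
    · exact absurd heq.symm (hne r' r h)
  · intro r
    rw [Fin.ne_iff_vne, Fin.ne_iff_vne]
    by_cases hr : r ∈ A
    · have h1 := graphOf_of_mem hij hA hr
      have h2 := placesBefore_lt hr
      omega
    · have h1 := graphOf_of_notMem hij hA hr
      omega
  · intro r r' hrr'
    simp only [graphOf_inner_iff hij hA]
    exact hord r r' hrr'

/-- A shuffle of two arcs corresponds to the set of places taken by the inner arc, with inverse
`graphOf`. -/
theorem card_graphs (hij : i < j) :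
    (graphs i j).card = (N + 1).choose (j.val - i.val - 1) := by
  classical
  have : (Finset.powersetCard (j.val - i.val - 1) (Finset.univ : Finset (Fin (N + 1)))).card =
      (N + 1).choose (j.val - i.val - 1) := by simp
  rw [← this]
  refine Finset.card_bij (fun τ _ => innerPlaces i j τ) ?_ ?_ ?_
  · intro τ hτ
    simp only [graphs, Finset.mem_filter, Finset.mem_univ, true_and] at hτ
    simp [Finset.mem_powersetCard, card_innerPlaces hij hτ]
  · intro τ hτ τ' hτ' heq
    simp only [graphs, Finset.mem_filter, Finset.mem_univ, true_and] at hτ hτ'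
    exact hτ.eq_of_innerPlaces_eq hij hτ' heq
  · intro A hA
    rw [Finset.mem_powersetCard] at hA
    refine ⟨graphOf j A, ?_, ?_⟩
    · simpa [graphs] using isGraph_graphOf hij hA.2
    · ext r
      simp [innerPlaces, graphOf_inner_iff hij hA.2]

end Graphs

/-! ### Reflection of the integration domain -/

theorem sum_extend {N : ℕ} (u : Fin N → ℝ) : ∑ r, extend u r = 1 := by
  simp [extend, Fin.sum_univ_castSucc]

/-- The reversal of `(u_1, …, u_N, 1 - ∑ u_i)` in terms of its first `N` components. -/
def reverseCoord {N : ℕ} (u : Fin N → ℝ) : Fin N → ℝ := fun k => extend u (Fin.rev k.castSucc)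

theorem extend_reverseCoord {N : ℕ} (u : Fin N → ℝ) (r : Fin (N + 1)) :
    extend (reverseCoord u) r = extend u r.rev := by
  have h : ∀ k : Fin N, extend (reverseCoord u) k.castSucc = extend u k.castSucc.rev := fun k => by
    rw [extend, Fin.snoc_castSucc]; rfl
  refine Fin.lastCases ?_ h r
  -- The last component is determined by the others, since both families sum to `1`.
  have h1 := sum_extend (reverseCoord u)
  have h2 : ∑ r, extend u (Fin.rev r) = 1 :=
    (Equiv.sum_comp Fin.revPerm (extend u)).trans (sum_extend u)
  rw [Fin.sum_univ_castSucc] at h1 h2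
  simp only [h] at h1
  linarith

theorem reverseCoord_involutive {N : ℕ} : Function.Involutive (reverseCoord (N := N)) := by
  intro u
  funext k
  change extend (reverseCoord u) (Fin.rev k.castSucc) = u k
  rw [extend_reverseCoord, Fin.rev_rev, extend, Fin.snoc_castSucc]

theorem extend_sub_extend_zero {N : ℕ} (u : Fin N → ℝ) (r : Fin (N + 1)) :
    extend u r - extend 0 r = Fin.snoc (α := fun _ => ℝ) u (-∑ k, u k) r := by
  refine Fin.lastCases ?_ (fun k => ?_) r <;> simp [extend]

/-- The linear part of `reverseCoord`. -/
def reverseLinear (N : ℕ) : (Fin N → ℝ) →ₗ[ℝ] (Fin N → ℝ) where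
  toFun u := reverseCoord u - reverseCoord 0
  map_add' u v := by
    funext k
    simp only [reverseCoord, Pi.sub_apply, Pi.add_apply, extend_sub_extend_zero]
    refine Fin.lastCases ?_ (fun i => ?_) (Fin.rev k.castSucc)
    · simp [Finset.sum_add_distrib, add_comm]
    · simp
  map_smul' c u := by
    funext k
    simp only [reverseCoord, Pi.sub_apply, Pi.smul_apply, extend_sub_extend_zero]
    refine Fin.lastCases ?_ (fun i => ?_) (Fin.rev k.castSucc)
    · simp [Finset.mul_sum]
    · simp

theorem reverseCoord_eq {N : ℕ} (u : Fin N → ℝ) :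
    reverseCoord u = reverseLinear N u + reverseCoord 0 := by
  simp [reverseLinear]

theorem reverseLinear_comp_self (N : ℕ) : reverseLinear N ∘ₗ reverseLinear N = LinearMap.id := by
  refine LinearMap.ext fun u => ?_
  have h1 := reverseCoord_involutive u
  have h2 := reverseCoord_involutive (0 : Fin N → ℝ)
  rw [reverseCoord_eq (reverseCoord u), reverseCoord_eq u, map_add] at h1
  rw [reverseCoord_eq (reverseCoord 0)] at h2
  rw [add_assoc, h2, add_zero] at h1
  exact h1

/-- The map is an affine involution, so its linear part squares to the identity and has determinant
`±1`. -/
theorem measurePreserving_reverseCoord (N : ℕ) :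
    MeasurePreserving (reverseCoord (N := N)) volume volume := by
  have hdet : LinearMap.det (reverseLinear N) * LinearMap.det (reverseLinear N) = 1 := by
    rw [← LinearMap.det_comp, reverseLinear_comp_self, LinearMap.det_id]
  have habs : |(LinearMap.det (reverseLinear N))⁻¹| = 1 := by
    rcases mul_self_eq_one_iff.mp hdet with h | h <;> simp [h]
  have hlin : MeasurePreserving (reverseLinear N) volume volume := by
    refine ⟨(LinearMap.continuous_of_finiteDimensional _).measurable, ?_⟩
    rw [Measure.map_linearMap_addHaar_eq_smul_addHaar volume
      (left_ne_zero_of_mul_eq_one hdet), habs, ENNReal.ofReal_one, one_smul]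
  have := (measurePreserving_add_right volume (reverseCoord (0 : Fin N → ℝ))).comp hlin
  have heq : reverseCoord (N := N) = (· + reverseCoord 0) ∘ reverseLinear N :=
    funext reverseCoord_eq
  rw [heq]
  exact this

/-- The reflection `(u, v) ↦ (v reversed, u reversed)` of the integration variables. -/
def reflect {N : ℕ} (w : (Fin N → ℝ) × (Fin N → ℝ)) : (Fin N → ℝ) × (Fin N → ℝ) :=
  (reverseCoord w.2, reverseCoord w.1)

theorem reflect_involutive {N : ℕ} : Function.Involutive (reflect (N := N)) := fun w =>
  Prod.ext (reverseCoord_involutive w.1) (reverseCoord_involutive w.2)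

theorem measurePreserving_reflect (N : ℕ) : MeasurePreserving (reflect (N := N)) volume volume :=
  ((measurePreserving_reverseCoord N).prod (measurePreserving_reverseCoord N)).comp
    Measure.measurePreserving_swap

/-- Exchanging `u` and `v` inverts the slopes `u_r / v_r` and so reverses their order; reversing the
places restores it. -/
theorem reflect_mem_domainΔ {N : ℕ} {w : (Fin N → ℝ) × (Fin N → ℝ)} (hw : w ∈ domainΔ N) :
    reflect w ∈ domainΔ N := by
  obtain ⟨h1, h2, h3⟩ := hw
  refine ⟨fun r => ?_, fun r => ?_, fun r r' hr => ?_⟩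
  · simpa only [reflect, extend_reverseCoord] using h2 _
  · simpa only [reflect, extend_reverseCoord] using h1 _
  · simp only [reflect, extend_reverseCoord]
    have := h3 r'.rev r.rev (Fin.rev_lt_rev.mpr hr)
    linarith

theorem setIntegral_domainΔ_reflect {N : ℕ} (f : (Fin N → ℝ) × (Fin N → ℝ) → ℂ) :
    ∫ w in domainΔ N, f (reflect w) = ∫ w in domainΔ N, f w := by
  have hpre : reflect ⁻¹' domainΔ N = domainΔ N := by
    ext w
    refine ⟨fun h => ?_, fun h => reflect_mem_domainΔ h⟩
    have := reflect_mem_domainΔ h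
    rwa [reflect_involutive] at this
  have hemb : MeasurableEmbedding (reflect (N := N)) :=
    (MeasurableEquiv.ofInvolutive _ reflect_involutive
      (measurePreserving_reflect N).measurable).measurableEmbedding
  have := (measurePreserving_reflect N).setIntegral_preimage_emb hemb f (domainΔ N)
  rwa [hpre] at this

/-! ### The contribution of one graph -/

/-- The exponent of a graph whose line has the ends `b 0`, `b 1` and whose leaves, in the order of
their places, are `b 2, b 3, …`. -/
def lineExponent {σ : Type*} {N : ℕ} (b : Fin (N + 3) → Fin 2 → MvPowerSeries σ ℂ)
    (w : (Fin N → ℝ) × (Fin N → ℝ)) : MvPowerSeries σ ℂ :=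
  ∑ r : Fin (N + 1), (((extend w.1 r : ℝ) : ℂ) • ang (b 0) (b r.succ.succ) +
    ((extend w.2 r : ℝ) : ℂ) • ang (b 1) (b r.succ.succ))

/-- The contribution of a graph whose line has the ends `b 0`, `b 1` and whose leaves, in the order
of their places, are `b 2, b 3, …`. -/
def lineTerm {σ : Type*} {N : ℕ} (b : Fin (N + 3) → Fin 2 → MvPowerSeries σ ℂ) :
    MvPowerSeries σ ℂ :=
  ang (b 0) (b 1) ^ N * (show MvPowerSeries σ ℂ from fun m =>
    ∫ w in domainΔ N, coeff m (fexp (lineExponent b w)))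

theorem VSub_eq_sum_lineTerm {σ : Type*} {N : ℕ} (i j : Fin (N + 3))
    (a : Fin (N + 3) → Fin 2 → MvPowerSeries σ ℂ) :
    VSub i j a = ((-1 : ℂ) ^ (i.val + j.val + 1)) • ∑ τ ∈ graphs i j,
      lineTerm (Matrix.vecCons (a i) (Matrix.vecCons (a j) fun r => leaf a (τ r))) := by
  rw [VSub, Finset.mul_sum]
  rfl

/-- Turning the line around reverses its leaves and exchanges the roles of `u` and `v`, which
`reflect` undoes under the integral. The sign comes from the antisymmetric prefactor `ang x y ^ N`.
-/
theorem lineTerm_reflect {σ : Type*} {N : ℕ} (x y : Fin 2 → MvPowerSeries σ ℂ)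
    (z : Fin (N + 1) → Fin 2 → MvPowerSeries σ ℂ) :
    lineTerm (Matrix.vecCons x (Matrix.vecCons y z)) =
      (-1 : ℂ) ^ N • lineTerm (Matrix.vecCons y (Matrix.vecCons x (z ∘ Fin.rev))) := by
  have hang : ang x y ^ N = (-1 : ℂ) ^ N • ang y x ^ N := by
    have : ang x y = (-1 : ℂ) • ang y x := by simp [ang]; ring
    rw [this, smul_pow]
  have hint : ∀ w, lineExponent (Matrix.vecCons x (Matrix.vecCons y z)) (reflect w) =
      lineExponent (Matrix.vecCons y (Matrix.vecCons x (z ∘ Fin.rev))) w := by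
    intro w
    simp only [lineExponent, reflect, extend_reverseCoord]
    rw [← Equiv.sum_comp Fin.revPerm]
    refine Finset.sum_congr rfl fun r _ => ?_
    rw [add_comm]
    simp [Fin.rev_rev]
  rw [lineTerm, lineTerm, ← smul_mul_assoc]
  refine congrArg₂ (· * ·) hang (funext fun m => ?_)
  refine (setIntegral_domainΔ_reflect _).symm.trans ?_
  simp only [hint]

theorem constantCoeff_lineExponent_slotY {N : ℕ} (w : (Fin N → ℝ) × (Fin N → ℝ)) :
    constantCoeff (lineExponent (slotY (N + 2)) w) = 0 := by
  rw [lineExponent, map_sum]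
  refine Finset.sum_eq_zero fun r _ => ?_
  rw [map_add, ← coeff_zero_eq_constantCoeff_apply, ← coeff_zero_eq_constantCoeff_apply,
    coeff_smul, coeff_smul, coeff_zero_eq_constantCoeff_apply, coeff_zero_eq_constantCoeff_apply,
    constantCoeff_ang (constantCoeff_slotY _), constantCoeff_ang (constantCoeff_slotY _),
    mul_zero, mul_zero, add_zero]

theorem renameSlots_ang_slotY {n : ℕ} {ρ : Equiv.Perm (Fin (n + 1))} (h0 : ρ 0 = 0)
    (k l : Fin (n + 1)) : renameSlots ρ (ang (slotY n k) (slotY n l)) =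
      ang (slotY n (ρ k)) (slotY n (ρ l)) := by
  refine (map_ang (renameSlots ρ).toRingHom (slotY n k) (slotY n l)).trans ?_
  congr 1 <;> funext α
  · exact renameSlots_slotY h0 k α
  · exact renameSlots_slotY h0 l α

theorem renameSlots_lineTerm {N : ℕ} {ρ : Equiv.Perm (Fin (N + 3))} (h0 : ρ 0 = 0) :
    renameSlots ρ (lineTerm (slotY (N + 2))) = lineTerm fun k => slotY (N + 2) (ρ k) := by
  rw [lineTerm, map_mul, map_pow, renameSlots_ang_slotY h0, lineTerm]
  congr 1
  ext m
  rw [coeff_renameSlots]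
  have hint : ∀ w, coeff (m.equivMapDomain (ρ.prodCongr (Equiv.refl SpVar)).symm)
      (fexp (lineExponent (slotY (N + 2)) w)) =
        coeff m (fexp (lineExponent (fun k => slotY (N + 2) (ρ k)) w)) := fun w => by
    rw [← coeff_renameSlots, renameSlots_fexp ρ (constantCoeff_lineExponent_slotY w)]
    congr 2
    simp only [lineExponent, map_sum, map_add, map_smul, renameSlots_ang_slotY h0]
  change ∫ w in domainΔ N, _ = ∫ w in domainΔ N, _
  simp only [hint]

/-- The value of the graph with the ends `y` and `∂_1`, whose leaves are `∂_2, ∂_3, …`, on a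
function `ω` in the first argument and copies of `c` in the others. -/
def basicValue (N : ℕ) (ω c : GF) (d : ℕ) : GF :=
  polyDiffPart (mhoOutput (N + 2) * lineTerm (slotY (N + 2)))
    (fun k : Fin (N + 2) => if k = 0 then ω else c) d

/-- The injection `f` is a permutation of the slots fixing the output and sending the first argument
to the position of `ω`. How it orders the leaves is irrelevant, as they all act on `c`. -/
theorem polyDiffPart_lineTerm {N : ℕ} {f : Fin (N + 3) → Fin (N + 3)}
    (hf : Function.Injective f) (h0 : f 0 = 0) {p : Fin (N + 2)} (h1 : f 1 = p.succ) (ω c : GF)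
    (d : ℕ) : polyDiffPart (mhoOutput (N + 2) * lineTerm fun k => slotY (N + 2) (f k))
      (fun k => if k = p then ω else c) d = basicValue N ω c d := by
  let ρ : Equiv.Perm (Fin (N + 3)) := Equiv.ofBijective f (Finite.injective_iff_bijective.mp hf)
  have hρ0 : ρ 0 = 0 := h0
  obtain ⟨π, hπ⟩ := exists_argument_perm hρ0
  have hπ0 : π 0 = p := Fin.succ_injective _ ((hπ 0).symm.trans h1)
  have hline : lineTerm (fun k => slotY (N + 2) (f k)) =
      renameSlots ρ (lineTerm (slotY (N + 2))) := (renameSlots_lineTerm hρ0).symm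
  rw [hline, ← renameSlots_mhoOutput hρ0, ← map_mul, polyDiffPart_renameSlots hρ0 hπ, basicValue]
  congr 1
  funext k
  have : π k = p ↔ k = 0 := by rw [← hπ0, π.injective.eq_iff]
  simp [this]

theorem vecCons_vecCons_injective {α : Type*} {n : ℕ} {x y : α} {z : Fin n → α} (hxy : x ≠ y)
    (hz : Function.Injective z) (hx : ∀ r, z r ≠ x) (hy : ∀ r, z r ≠ y) :
    Function.Injective (Matrix.vecCons x (Matrix.vecCons y z)) := by
  refine Fin.cons_injective_iff.mpr ⟨?_, Fin.cons_injective_iff.mpr ⟨?_, hz⟩⟩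
  · rintro ⟨r, hr⟩
    revert hr
    refine Fin.cases (fun hr => hxy hr.symm) (fun r hr => hx r hr) r
  · rintro ⟨r, hr⟩
    exact hy r hr

theorem comp_vecCons_vecCons {α β : Type*} {n : ℕ} (g : α → β) (x y : α) (z : Fin n → α) :
    (fun k => g (Matrix.vecCons x (Matrix.vecCons y z) k)) =
      Matrix.vecCons (g x) (Matrix.vecCons (g y) fun r => g (z r)) := by
  funext k
  refine Fin.cases rfl (fun k => Fin.cases rfl (fun _ => rfl) k) k

/-! ### Signed graph counts for each position of the 1-form, and their cancellation -/

theorem polyDiffPart_sum_smul {n : ℕ} {ι : Type*} {s : Finset ι} {f : ι → Symb n} {G : Symb n}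
    {Φ : Fin n → GF} {d : ℕ} {V : GF} (h : ∀ τ ∈ s, polyDiffPart (G * f τ) Φ d = V) (c : ℂ) :
    polyDiffPart (G * c • ∑ τ ∈ s, f τ) Φ d = (c * s.card) • V := by
  rw [mul_smul_comm, polyDiffPart_smul, Finset.mul_sum]
  have : polyDiffPart (∑ τ ∈ s, G * f τ) Φ d = ∑ τ ∈ s, polyDiffPart (G * f τ) Φ d :=
    map_sum (polyDiffPartₗ Φ d) _ _
  rw [this, Finset.sum_congr rfl h, Finset.sum_const, mul_smul, Nat.cast_smul_eq_nsmul]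

theorem polyDiffPart_USub_of_ne_last {N : ℕ} {p : Fin (N + 2)} (hp : p ≠ Fin.last (N + 1))
    (ω c : GF) (d : ℕ) :
    polyDiffPart (mhoOutput (N + 2) * USub p (slotY (N + 2))) (fun k => if k = p then ω else c) d =
      ((-1 : ℂ) ^ p.val * ((N + 1).choose p.val : ℕ)) • basicValue N ω c d := by
  have hpv : p.val < N + 1 := Fin.val_lt_last hp
  have hj : (p.succ + 1 : Fin (N + 3)).val = p.val + 2 := by
    rw [Fin.val_add_one_of_lt (by rw [Fin.lt_def]; simp; omega)]; simp
  have hij : (1 : Fin (N + 3)) < p.succ + 1 := by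
    rw [Fin.lt_def, hj, Fin.val_one]; omega
  rw [USub, if_pos hp, VSub_eq_sum_lineTerm, polyDiffPart_sum_smul (V := basicValue N ω c d),
    card_graphs hij]
  · congr 1
    -- With `i = 1` and `j = p + 2` there are `p` slots on the inner arc, and the sign is `(-1) ^ (p
    -- + 4)`.
    rw [hj, Fin.val_one, show p.val + 2 - 1 - 1 = p.val by omega,
      show 1 + (p.val + 2) + 1 = p.val + 2 * 2 by ring, pow_add, pow_mul]
    norm_num
  · intro τ hτ
    simp only [graphs, Finset.mem_filter, Finset.mem_univ, true_and] at hτ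
    -- The minus sign that the pairing puts on slot `0` cancels the one in `leaf`, so all leaves
    -- enter uniformly.
    have hleaf : ∀ k : Fin (N + 3), leaf (fun k : Fin (N + 3) =>
        if k = 0 then -slotY (N + 2) (k - 1) else slotY (N + 2) (k - 1)) k =
          slotY (N + 2) (k - 1) := by
      intro k
      by_cases hk : k = 0 <;> simp [leaf, hk]
    have hj0 : p.succ + 1 ≠ (0 : Fin (N + 3)) := by
      rw [Fin.ne_iff_vne, hj]; simp
    simp only [hleaf, if_neg hj0, if_neg (one_ne_zero : (1 : Fin (N + 3)) ≠ 0), sub_self,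
      add_sub_cancel_right]
    rw [← comp_vecCons_vecCons (slotY (N + 2)) 0 p.succ fun r => τ r - 1]
    refine polyDiffPart_lineTerm (vecCons_vecCons_injective (Fin.succ_ne_zero p).symm
      (fun r s h => hτ.1 (sub_left_injective h)) (fun r h => ?_) fun r h => ?_) rfl rfl ω c d
    · exact (hτ.2.1 r).1 (sub_eq_zero.mp h)
    · exact (hτ.2.1 r).2 (sub_eq_iff_eq_add.mp h)

/-- The ends are neighbouring slots, so there is a single graph, and `i + j + 1 = 2 (N + 2)` gives
no sign. The ends come as the derivative on `ω` followed by `y`; reflection contributes `(-1) ^ N`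
and the pairing the outer minus. -/
theorem polyDiffPart_USub_last (N : ℕ) (ω c : GF) (d : ℕ) :
    polyDiffPart (mhoOutput (N + 2) * USub (Fin.last (N + 1)) (slotY (N + 2)))
      (fun k => if k = Fin.last (N + 1) then ω else c) d =
      (-(-1 : ℂ) ^ N) • basicValue N ω c d := by
  have hi : (Fin.last (N + 2) - 1 : Fin (N + 3)).val = N + 1 := by
    rw [Fin.sub_val_of_le (by rw [Fin.le_def]; simp), Fin.val_last, Fin.val_one]; rfl
  have hij : (Fin.last (N + 2) - 1 : Fin (N + 3)) < Fin.last (N + 2) := by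
    rw [Fin.lt_def, hi, Fin.val_last]; omega
  have hneg : ∀ F : Symb (N + 2), mhoOutput (N + 2) * -F = (-1 : ℂ) • (mhoOutput (N + 2) * F) :=
    fun F => by rw [neg_smul, one_smul, mul_neg]
  rw [USub, if_neg (not_not.mpr rfl), VSub_eq_sum_lineTerm, hneg, polyDiffPart_smul,
    polyDiffPart_sum_smul (V := (-1 : ℂ) ^ N • basicValue N ω c d), card_graphs hij, smul_smul,
    smul_smul]
  · congr 1
    rw [hi, Fin.val_last, show N + 2 - (N + 1) - 1 = 0 by omega,
      show N + 1 + (N + 2) + 1 = 2 * (N + 2) by ring, pow_mul]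
    norm_num
  · intro τ hτ
    simp only [graphs, Finset.mem_filter, Finset.mem_univ, true_and] at hτ
    have hleaf : ∀ k : Fin (N + 3), leaf (fun k : Fin (N + 3) =>
        if k = 0 then -slotY (N + 2) (k + 1) else slotY (N + 2) (k + 1)) k =
          slotY (N + 2) (k + 1) := by
      intro k
      by_cases hk : k = 0 <;> simp [leaf, hk]
    have hi0 : Fin.last (N + 2) - 1 ≠ (0 : Fin (N + 3)) := by
      rw [Fin.ne_iff_vne, hi]; simp
    have hj0 : Fin.last (N + 2) ≠ (0 : Fin (N + 3)) := Fin.last_pos.ne'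
    simp only [hleaf, if_neg hi0, if_neg hj0, sub_add_cancel, Fin.last_add_one]
    rw [lineTerm_reflect, mul_smul_comm, polyDiffPart_smul]
    refine congrArg (fun V : GF => (-1 : ℂ) ^ N • V) ?_
    have hrev : (fun r => slotY (N + 2) (τ r + 1)) ∘ Fin.rev =
        fun r => slotY (N + 2) (τ (Fin.rev r) + 1) := rfl
    rw [hrev, ← comp_vecCons_vecCons (slotY (N + 2)) 0 (Fin.last (N + 2)) fun r =>
      τ (Fin.rev r) + 1]
    refine polyDiffPart_lineTerm (vecCons_vecCons_injective hj0.symm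
      (fun r s h => Fin.rev_injective (hτ.1 (add_left_injective _ h))) (fun r h => ?_)
      fun r h => ?_) rfl (Fin.succ_last _).symm ω c d
    · refine (hτ.2.1 (Fin.rev r)).2 (add_left_injective 1 ?_)
      exact h.trans (Fin.last_add_one _).symm
    · exact (hτ.2.1 (Fin.rev r)).1 (eq_sub_of_add_eq h)

/-- This is the vanishing alternating sum of row `N + 1` without its last term `(-1) ^ (N + 1)`. -/
theorem sum_graph_signs (N : ℕ) :
    ∑ p : Fin (N + 1), (-1 : ℂ) ^ p.val * ((N + 1).choose p.val : ℕ) = (-1) ^ N := by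
  have h := Int.alternating_sum_range_choose_of_ne (n := N + 1) (by omega)
  rw [Finset.sum_range_succ, Nat.choose_self, ← Fin.sum_univ_eq_sum_range
    (fun p => (-1 : ℤ) ^ p * ((N + 1).choose p : ℤ))] at h
  have h' := congrArg (Int.cast : ℤ → ℂ) h
  push_cast at h'
  rw [eq_neg_of_add_eq_zero_left h', pow_succ]
  ring

/-- A vertex vanishes on fields that depend on the dotted variables only through `[y λ]`. -/
theorem UVertexPart_eq_zero {l : Fin 2 → ℂ} (hl : l ≠ 0) (N : ℕ) {ω c : GF}
    (hω : dotD l ω = 0) (hc : dotD l c = 0) (d : ℕ) : UVertexPart N ω c d = 0 := by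
  have hΦ : ∀ p k : Fin (N + 2), dotD l (if k = p then ω else c) = 0 := fun p k => by
    split_ifs <;> assumption
  simp only [UVertexPart, USymb, polyDiffPart_smul, polyDiffPart_mho_mul hl (hΦ _)]
  -- The normalisation does not depend on the position of `ω`, so it factors out of the sum.
  rw [← Finset.smul_sum, Fin.sum_univ_castSucc, polyDiffPart_USub_last]
  simp only [polyDiffPart_USub_of_ne_last (Fin.castSucc_lt_last _).ne, Fin.val_castSucc]
  rw [← Finset.sum_smul, sum_graph_signs, ← add_smul, add_neg_cancel, zero_smul, smul_zero]

end ChiralHS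

end

theorem theorem2 (M : Set ChiralHS.Spacetime) (hM : IsOpen M)
    (lam lamd mu mud : Fin 2 → ℂ)
    (hml : ChiralHS.ang mu lam = 1) (hmlt : ChiralHS.ang mud lamd = 1)
    (H ψ : ℕ → ChiralHS.Spacetime → ℂ)
    (hH : ∀ s, 1 ≤ s → ChiralHS.IsHarmonicProfile M lam lamd mu mud (H s))
    (hHsd : ∀ s, 1 ≤ s → ∀ x ∈ M, ChiralHS.dirD (ChiralHS.outer mu lamd) (H s) x = 0)
    (hψ : ∀ s, ChiralHS.IsHarmonicProfile M lam lamd mu mud (ψ s))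
    (B : ℕ → ChiralHS.Spacetime → ChiralHS.GF)
    (hB : ∀ s, ∀ x ∈ M, ChiralHS.IsBSpin lam lamd mu (ψ s x) s (B s x)) :
    ∀ N : ℕ, ∀ x ∈ M, ∀ ξ : ChiralHS.Spacetime,
      (∀ d : ℕ, ChiralHS.UVertexPart N (ChiralHS.omegaField lam lamd mud H x ξ)
        (ChiralHS.zeroFormField lam lamd mud H B x) d = 0) ∧
      ChiralHS.UVertexEq N (ChiralHS.omegaField lam lamd mud H x ξ)
        (ChiralHS.zeroFormField lam lamd mud H B x) 0 := by
  intro N x hx ξ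
  -- A zero `lamd` would contradict `[μ̃ λ̃] = 1`.
  have hlamd : lamd ≠ 0 := by
    rintro rfl
    simp [ChiralHS.ang] at hmlt
  have hzero := ChiralHS.UVertexPart_eq_zero hlamd N
    (ChiralHS.dotD_omegaField lam lamd mud H x ξ)
    (ChiralHS.dotD_zeroFormField (mud := mud) (H := H) fun s => hB s x hx)
  refine ⟨hzero, fun e => ?_⟩
  simp only [hzero, map_zero]
  exact hasSum_zero
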